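/- Let $K$ be a field of characteristic zero (for instance $\mathbb{C}$, or the rational function field $\mathbb{Q}(\varepsilon, a_1,\dots,a_r, m_1,\dots,m_r,\theta)$), let $r \ge 0$ be an integer, and let $[r]=\{1,\dots,r\} = J_0 \sqcup J_1$, $r_0=|J_0|$, $r_1=|J_1|$. Let $\varepsilon \in K\setminus\{0\}$ and $a_1,\dots,a_r \in K$ be such that the denominators below do not vanish, that is: $a_\alpha - a_\beta \notin \varepsilon\mathbb{Z}$ for distinct $\alpha,\beta \in J_0$ and for distinct $\alpha,\beta\in J_1$, and $a_\alpha - a_\beta \notin \varepsilon \mathbb{Z}_{>0}$ for $\alpha\in J_0$, $\beta\in J_1$. Write $(x)_k = x(x+1)\cdots(x+k-1)$, $\Delta_J(x) = \prod_{\alpha,\beta\in J,\ \alpha<\beta}(x_\alpha-x_\beta)$, $|k|=\sum_\alpha k_\alpha$, and $(1-u)^s=\sum_{n\ge 0}\binom{s}{n}(-u)^n$ for $s\in K$. Then the following identities of formal power series hold. (a) For all $m_1,\dots,m_r\in K$, with $A=\sum_{\alpha=1}^r (a_\alpha/\varepsilon+m_\alpha/\varepsilon)$, in $K[[u]]$: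 $$\sum_{k\in\mathbb{Z}_{\ge0}^{J_1}} u^{|k|}\,\frac{\Delta_{J_1}(a/\varepsilon+k)}{\Delta_{J_1}(a/\varepsilon)} \prod_{\alpha\in J_1,\ \beta\in J_1}\frac{\left(\frac{m_\beta}{\varepsilon}+\frac{a_\alpha}{\varepsilon}\right)_{k_\alpha}}{\left(1+\frac{a_\alpha}{\varepsilon}-\frac{a_\beta}{\varepsilon}\right)_{k_\alpha}} \prod_{\alpha\in J_1,\ \beta\in J_0}\frac{\left(\frac{m_\beta}{\varepsilon}+\frac{a_\alpha}{\varepsilon}\right)_{k_\alpha}}{\left(1+\frac{a_\alpha}{\varepsilon}-\frac{a_\beta}{\varepsilon}\right)_{k_\alpha}}$$ $$=(1-u)^{-A+r_0}\sum_{k\in\mathbb{Z}_{\ge0}^{J_0}} u^{|k|}\,\frac{\Delta_{J_0}(-a/\varepsilon+k)}{\Delta_{J_0}(-a/\varepsilon)} \prod_{\alpha\in J_0,\ \beta\in J_0}\frac{\left(-\frac{m_\beta}{\varepsilon}+1-\frac{a_\alpha}{\varepsilon}\right)_{k_\alpha}}{\left(1-\frac{a_\alpha}{\varepsilon}+\frac{a_\beta}{\varepsilon}\right)_{k_\alpha}}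 \prod_{\beta\in J_0,\ \alpha\in J_1}\frac{\left(-\frac{m_\alpha}{\varepsilon}+1-\frac{a_\beta}{\varepsilon}\right)_{k_\beta}}{\left(\frac{a_\alpha}{\varepsilon}+1-\frac{a_\beta}{\varepsilon}\right)_{k_\beta}}.$$ (b) For all $\theta\in K$, in $K[[p]]$: $$\sum_{k\in\mathbb{Z}_{\ge0}^{J_1}} p^{|k|} \prod_{\beta\in J_1,\ \alpha\in J_1}\frac{\left(\frac{a_\alpha}{\varepsilon}-\frac{a_\beta}{\varepsilon}-\frac{\theta}{\varepsilon}-k_\beta\right)_{k_\alpha}}{\left(\frac{a_\alpha}{\varepsilon}-\frac{a_\beta}{\varepsilon}-k_\beta\right)_{k_\alpha}} \prod_{\beta\in J_1,\ \alpha\in J_0}\frac{\left(\frac{a_\alpha}{\varepsilon}-\frac{a_\beta}{\varepsilon}-\frac{\theta}{\varepsilon}-k_\beta\right)_{k_\beta}}{\left(\frac{a_\alpha}{\varepsilon}-\frac{a_\beta}{\varepsilon}-k_\beta\right)_{k_\beta}}$$ $$=(1-p)^{(r_0-r_1)(\theta/\varepsilon+1)}\sum_{k\in\mathbb{Z}_{\ge0}^{J_0}}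 p^{|k|} \prod_{\beta\in J_0,\ \alpha\in J_0}\frac{\left(\frac{a_\beta}{\varepsilon}-\frac{a_\alpha}{\varepsilon}-\frac{\theta}{\varepsilon}-k_\beta\right)_{k_\alpha}}{\left(\frac{a_\beta}{\varepsilon}-\frac{a_\alpha}{\varepsilon}-k_\beta\right)_{k_\alpha}} \prod_{\beta\in J_0,\ \alpha\in J_1}\frac{\left(\frac{a_\beta}{\varepsilon}-\frac{a_\alpha}{\varepsilon}-\frac{\theta}{\varepsilon}-k_\beta\right)_{k_\beta}}{\left(\frac{a_\beta}{\varepsilon}-\frac{a_\alpha}{\varepsilon}-k_\beta\right)_{k_\beta}}.$$ -/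

import Mathlib

open Finset

namespace WallCrossing

noncomputable section

/-- The Pochhammer symbol `(x)_k = x (x + 1) ⋯ (x + (k - 1))`. -/
def poch {K : Type*} [Field K] (x : K) (k : ℕ) : K :=
  (ascPochhammer K k).eval x

/-- The Vandermonde product `Δ_J(x) = ∏_{α, β ∈ J, α < β} (x_α - x_β)`. -/
def vandermonde {K : Type*} [Field K] {r : ℕ} (J : Finset (Fin r)) (x : Fin r → K) : K :=
  ∏ α ∈ J, ∏ β ∈ J with α < β, (x α - x β)

/-- The formal power series `∑_k u^{|k|} c(k)` in the variable `u`, where `k` runs over `ℕ^J`,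
regarded as the set of `k : Fin r → ℕ` that vanish outside `J`. Its coefficient at `u^n` is the
finite sum of the `c(k)` with `|k| = n`. -/
def multiSeries {K : Type*} [Field K] {r : ℕ} (J : Finset (Fin r)) (c : (Fin r → ℕ) → K) :
    PowerSeries K :=
  PowerSeries.mk fun n => ∑ k ∈ J.piAntidiag n, c k

/-- The binomial series `(1 - u)^s = ∑_n (s choose n) (-u)^n` with exponent `s` in `K`. -/
def oneSubPow {K : Type*} [Field K] [CharZero K] (s : K) : PowerSeries K :=
  PowerSeries.rescale (-1) (PowerSeries.binomialSeries K s)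

end

end WallCrossing

/-! Write `x = a / ε`, `I = J₁`, `J = J₀`. Both identities rest on one fact: the residues of `∏ (z -
a_j) / (z - b_j)` at its simple poles sum to `∑ (b_j - a_j)` (`sum_residues`).

For (a), let `L` and `R` be the two series and let `W` be the weight of `L * R`, indexed by all `κ :
Fin r → ℕ`. Put `y = x + κ` on `I` and `y = x - κ` on `J`. The residues of `∏ (z - x_δ) / (z - y_δ)`
sum to `|κ_I| - |κ_J|`, the eigenvalue of `W κ` under `L, R ↦ u (L' R - L R')`. Those of `∏ (z +
m_δ) / (z - P_δ)`, where `P = y` on `I` and `y - 1` on `J`, sum to the same number plus `A - #J`.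
Raising `κ_γ` by one carries the second kind of residue to the first, weights included. Summing over
`κ` gives `(1 - u) (L' R - L R') = (A - #J) L R`, which determines `L / R`.

For (b), argue by strong induction on the order `N` in `p`. Translate the coordinates in `J` by `t`.
The coefficients on both sides become rational in `t`, with simple poles for generic `x`, so it
suffices to match values at infinity and residues. At infinity the interaction between `I` and `J`
disappears and each side reduces to the case of an empty second set, summed in closed form by
`sum_sourceWeight_empty`. At the pole `x α - x β + 1 + s`, the residue is a factor common to both
sides times the same identity of order `N - (s + 1)`, at a point where `α` and `β` have exchanged
coordinates (`mixedResidue_add_single`). Non-generic `x` follow because both sides are rational and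
regular along a line through `x` (`RegularAt.eq_of_finite`).

The closed form is again a residue argument, with an auxiliary parameter `j`: residues at level `j`
for `k + e_α` match residues at level `j + 1` for `k`, and the resulting recursion is closed by the
vanishing of one family at `j = 0`. -/

namespace WallCrossing

/-! ### Residue sums and partial fractions by Lagrange interpolation -/

section Residues

variable {K ι : Type*} [Field K]

open Polynomial in
theorem degree_prod_X_sub_C_sub_lt (S : Finset ι) (a b : ι → K) :
    (∏ j ∈ S, (X - C (a j)) - ∏ j ∈ S, (X - C (b j)) : K[X]).degree < #S := by
  rcases S.eq_empty_or_nonempty with rfl | hS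
  · simp
  have hd : ∀ c : ι → K, (∏ j ∈ S, (X - C (c j)) : K[X]).degree = #S := fun c => by
    simp [degree_prod]
  rw [← hd a]
  refine degree_sub_lt_left (by rw [hd, hd]) ?_ ?_
  · exact (monic_prod_X_sub_C a S).ne_zero
  · rw [(monic_prod_X_sub_C a S).leadingCoeff, (monic_prod_X_sub_C b S).leadingCoeff]

variable [DecidableEq ι]

-- Interpolate `∏ (X - a_j) - ∏ (X - b_j)` at the nodes `b` and compare coefficients of degree `#S -
-- 1`. Only the `b_j` must be distinct; a zero may coincide with a pole.
open Polynomial in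
theorem sum_residues (S : Finset ι) (a b : ι → K) (hb : Set.InjOn b S) :
    ∑ j ∈ S, (b j - a j) * ∏ l ∈ S.erase j, ((b j - a l) / (b j - b l)) =
      ∑ j ∈ S, (b j - a j) := by
  rcases S.eq_empty_or_nonempty with rfl | hS
  · simp
  set P : K[X] := ∏ j ∈ S, (X - C (a j)) - ∏ j ∈ S, (X - C (b j)) with hP
  have hdeg : P.degree < #S := degree_prod_X_sub_C_sub_lt S a b
  have hint := Lagrange.eq_interpolate hb hdeg
  have hcard : 0 < #S := hS.card_pos
  have h1 : P.coeff (#S - 1) = ∑ j ∈ S, (b j - a j) := by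
    rw [hP, coeff_sub, prod_X_sub_C_coeff_card_pred _ _ hcard,
      prod_X_sub_C_coeff_card_pred _ _ hcard, sum_sub_distrib]
    ring
  rw [← h1]
  conv_rhs => rw [hint]
  rw [Lagrange.interpolate_apply, finsetSum_coeff]
  refine sum_congr rfl fun j hj => ?_
  rw [coeff_C_mul]
  have hc : (Lagrange.basis S b j).coeff (#S - 1) = ∏ l ∈ S.erase j, (b j - b l)⁻¹ := by
    rw [prod_inv_distrib, ← Lagrange.leadingCoeff_basis hb hj, leadingCoeff,
      natDegree_eq_of_degree_eq_some (Lagrange.degree_basis hb hj)]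
  rw [hc, hP, eval_sub, eval_prod, eval_prod, ← mul_prod_erase S _ hj,
    prod_eq_zero (i := j) (s := S) (f := fun l => eval (b j) (X - C (b l))) hj (by simp)]
  simp only [eval_sub, eval_X, eval_C, sub_zero, div_eq_mul_inv, prod_mul_distrib]
  ring

-- The same interpolation, evaluated at `t` instead of read off at the top coefficient: the quotient
-- tends to `1` at infinity, and the sum is over its simple poles.
open Polynomial in
theorem prod_div_eq_one_add_sum (S : Finset ι) (a b : ι → K) (hb : Set.InjOn b S) (t : K)
    (ht : ∀ j ∈ S, t ≠ b j) :
    ∏ j ∈ S, ((t - a j) / (t - b j)) =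
      1 + ∑ j ∈ S, (t - b j)⁻¹ *
        ((b j - a j) * ∏ l ∈ S.erase j, ((b j - a l) / (b j - b l))) := by
  set P : K[X] := ∏ j ∈ S, (X - C (a j)) - ∏ j ∈ S, (X - C (b j)) with hP
  have hint := Lagrange.eq_interpolate hb (degree_prod_X_sub_C_sub_lt S a b)
  have h1 := congrArg (eval t) hint
  rw [Lagrange.eval_interpolate_not_at_node _ ht, eval_sub, eval_prod, eval_prod,
    Lagrange.eval_nodal] at h1
  simp only [eval_sub, eval_X, eval_C] at h1
  have hne : ∏ j ∈ S, (t - b j) ≠ 0 := prod_ne_zero_iff.2 fun j hj => sub_ne_zero.2 (ht j hj)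
  rw [prod_div_distrib, div_eq_iff hne, add_mul, one_mul, ← sub_eq_iff_eq_add', h1, mul_comm]
  congr 1
  refine sum_congr rfl fun j hj => ?_
  rw [eval_prod, eval_prod, ← mul_prod_erase S _ hj,
    prod_eq_zero (i := j) (s := S) (f := fun l => eval (b j) (X - C (b l))) hj (by simp),
    Lagrange.nodalWeight]
  simp only [eval_sub, eval_X, eval_C, sub_zero, div_eq_mul_inv, prod_mul_distrib]
  ring

end Residues

/-! ### Shifting multi-indices of fixed total degree -/

section Compositions

variable {ι M : Type*} [DecidableEq ι] [AddCommMonoid M]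

theorem sum_piAntidiag_add (J : Finset ι) (n s : ℕ) {α : ι} (hα : α ∈ J) (g : (ι → ℕ) → M) :
    ∑ k ∈ J.piAntidiag (n + s) with s ≤ k α, g k =
      ∑ k ∈ J.piAntidiag n, g (k + Pi.single α s) := by
  symm
  have key : ∀ k : ι → ℕ, s ≤ k α → Pi.single α s ≤ k := by
    intro k h i
    by_cases e : i = α
    · subst e; simpa using h
    · simp [e]
  refine sum_bij' (fun k _ => k + Pi.single α s) (fun k _ => k - Pi.single α s) ?_ ?_ ?_ ?_ ?_
  · intro k h
    simp only [mem_piAntidiag, mem_filter] at h ⊢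
    refine ⟨⟨?_, fun i hi => ?_⟩, by simp⟩
    · simp [sum_add_distrib, h.1, hα]
    · by_cases e : i = α
      · exact e ▸ hα
      · exact h.2 i (by simpa [e] using hi)
  · intro k h
    simp only [mem_piAntidiag, mem_filter] at h ⊢
    refine ⟨?_, fun i hi => h.1.2 i fun e => hi (by simp [e])⟩
    have := congrArg (fun f : ι → ℕ => ∑ i ∈ J, f i) (tsub_add_cancel_of_le (key k h.2))
    simp only [Pi.add_apply, sum_add_distrib, h.1.1, sum_pi_single', hα, if_true] at this
    exact Nat.add_right_cancel this
  · intro k h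
    simp
  · intro k h
    simp only [mem_piAntidiag, mem_filter] at h
    exact tsub_add_cancel_of_le (key k h.2)
  · intro k h
    rfl

theorem le_of_mem_piAntidiag {J : Finset ι} {n : ℕ} {k : ι → ℕ} (hk : k ∈ J.piAntidiag n) {α : ι}
    (hα : α ∈ J) : k α ≤ n := by
  rw [← (mem_piAntidiag.1 hk).1]
  exact single_le_sum (fun _ _ => Nat.zero_le _) hα

/-- Reindexing for the recursions in the degree: a multi-index with a marked nonzero coordinate is a
smaller one with a unit added there. -/
theorem sum_piAntidiag_succ (J : Finset ι) (n : ℕ) (g : ι → (ι → ℕ) → M) :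
    ∑ k ∈ J.piAntidiag (n + 1), ∑ α ∈ J with k α ≠ 0, g α k =
      ∑ k ∈ J.piAntidiag n, ∑ α ∈ J, g α (k + Pi.single α 1) := by
  simp_rw [sum_filter]
  rw [sum_comm, sum_comm (s := J.piAntidiag n)]
  refine sum_congr rfl fun α hα => ?_
  rw [← sum_piAntidiag_add J n 1 hα, sum_filter]
  simp_rw [Nat.one_le_iff_ne_zero]

end Compositions

/-! ### Products of multi-index series and the binomial series -/

section Series

variable {K : Type*} [Field K]

/-- A multi-index on `I ∪ J` is a pair of its restrictions. The locality hypotheses allow each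
weight to be evaluated on the unrestricted multi-index. -/
theorem multiSeries_mul {r : ℕ} {I J : Finset (Fin r)} (h : Disjoint I J)
    (c d : (Fin r → ℕ) → K) (hc : ∀ k l, (∀ i ∈ I, k i = l i) → c k = c l)
    (hd : ∀ k l, (∀ i ∈ J, k i = l i) → d k = d l) :
    multiSeries I c * multiSeries J d = multiSeries (I ∪ J) fun k => c k * d k := by
  ext n
  simp only [multiSeries, PowerSeries.coeff_mul, PowerSeries.coeff_mk]
  simp_rw [sum_mul_sum, ← sum_product']
  rw [sum_sigma']
  have hIJ : ∀ i ∈ I, i ∉ J := fun i hi hj => disjoint_left.1 h hi hj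
  refine sum_bij' (fun p _ => p.2.1 + p.2.2)
    (fun k _ => ⟨(∑ i ∈ I, k i, ∑ i ∈ J, k i),
      (fun i => if i ∈ I then k i else 0, fun i => if i ∈ J then k i else 0)⟩) ?_ ?_ ?_ ?_ ?_
  · rintro ⟨⟨m, m'⟩, k, l⟩ hp
    simp only [mem_sigma, HasAntidiagonal.mem_antidiagonal, mem_product, mem_piAntidiag] at hp ⊢
    obtain ⟨hn, ⟨hk, hk'⟩, hl, hl'⟩ := hp
    constructor
    · rw [sum_union h, ← hn, ← hk, ← hl]
      congr 1
      · exact sum_congr rfl fun i hi => by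
          have : l i = 0 := by_contra fun e => hIJ i hi (hl' i e)
          simp [this]
      · exact sum_congr rfl fun i hi => by
          have : k i = 0 := by_contra fun e => hIJ i (hk' i e) hi
          simp [this]
    · intro i hi
      by_contra hc
      simp only [mem_union, not_or] at hc
      exact hi (by simp [by_contra fun e => hc.1 (hk' i e), by_contra fun e => hc.2 (hl' i e)])
  · intro k hk
    simp only [mem_piAntidiag, mem_sigma, HasAntidiagonal.mem_antidiagonal, mem_product] at hk ⊢
    rw [sum_union h] at hk
    refine ⟨hk.1, ⟨sum_congr rfl fun i hi => by simp [hi], fun i hi => ?_⟩,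
      sum_congr rfl fun i hi => by simp [hi], fun i hi => ?_⟩
    · by_contra e; simp [e] at hi
    · by_contra e; simp [e] at hi
  · rintro ⟨⟨m, m'⟩, k, l⟩ hp
    simp only [mem_sigma, HasAntidiagonal.mem_antidiagonal, mem_product, mem_piAntidiag] at hp
    obtain ⟨hn, ⟨hk, hk'⟩, hl, hl'⟩ := hp
    have e1 : (fun i => if i ∈ I then (k + l) i else 0) = k := by
      funext i
      by_cases hi : i ∈ I
      · have : l i = 0 := by_contra fun e => hIJ i hi (hl' i e)
        simp [hi, this]
      · simp [hi, (by_contra fun e => hi (hk' i e) : k i = 0)]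
    have e2 : (fun i => if i ∈ J then (k + l) i else 0) = l := by
      funext i
      by_cases hi : i ∈ J
      · have : k i = 0 := by_contra fun e => hIJ i (hk' i e) hi
        simp [hi, this]
      · simp [hi, (by_contra fun e => hi (hl' i e) : l i = 0)]
    have e3 : ∑ i ∈ I, (k + l) i = m := by
      rw [← hk]; exact sum_congr rfl fun i hi => by conv_rhs => rw [← e1]
                                                    simp [hi]
    have e4 : ∑ i ∈ J, (k + l) i = m' := by
      rw [← hl]; exact sum_congr rfl fun i hi => by conv_rhs => rw [← e2]
                                                    simp [hi]
    simp only [e1, e2, e3, e4]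
  · intro k hk
    simp only [mem_piAntidiag] at hk
    funext i
    simp only [Pi.add_apply]
    by_cases hi : i ∈ I
    · simp [hi, hIJ i hi]
    · by_cases hj : i ∈ J
      · simp [hi, hj]
      · have : k i = 0 := by_contra fun e => by simpa [hi, hj] using hk.2 i e
        simp [this]
  · rintro ⟨⟨m, m'⟩, k, l⟩ hp
    simp only [mem_sigma, HasAntidiagonal.mem_antidiagonal, mem_product, mem_piAntidiag] at hp
    obtain ⟨hn, ⟨hk, hk'⟩, hl, hl'⟩ := hp
    congr 1
    · refine hc _ _ fun i hi => ?_
      have : l i = 0 := by_contra fun e => hIJ i hi (hl' i e)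
      simp [this]
    · refine hd _ _ fun i hi => ?_
      have : k i = 0 := by_contra fun e => hIJ i (hk' i e) hi
      simp [this]

variable [CharZero K]

theorem coeff_zero_oneSubPow (s : K) : PowerSeries.coeff 0 (oneSubPow s) = 1 := by
  simp [oneSubPow]

theorem succ_mul_coeff_oneSubPow (s : K) (n : ℕ) :
    (n + 1 : K) * PowerSeries.coeff (n + 1) (oneSubPow s) =
      (n - s) * PowerSeries.coeff n (oneSubPow s) := by
  have h0 : (Nat.factorial n : K) ≠ 0 := Nat.cast_ne_zero.2 n.factorial_ne_zero
  have h1 : (n + 1 : K) ≠ 0 := by exact_mod_cast n.succ_ne_zero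
  simp only [oneSubPow, PowerSeries.coeff_rescale, PowerSeries.binomialSeries_coeff,
    Ring.choose_eq_smul, Nat.factorial_succ, descPochhammer_succ_right]
  simp only [Polynomial.smeval_mul, Polynomial.smeval_sub, Polynomial.smeval_X,
    Polynomial.smeval_natCast, smul_eq_mul, Nat.cast_mul, Nat.cast_add, Nat.cast_one, pow_succ,
    pow_zero, mul_one, nsmul_eq_mul, one_mul]
  field_simp
  ring

theorem oneSubPow_add (s t : K) : oneSubPow (s + t) = oneSubPow s * oneSubPow t := by
  simp [oneSubPow]

/-- The recurrence is `f' = -s f / (1 - u)` with `1 / (1 - u)` expanded; subtracting consecutive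
instances gives the two-term recurrence of the binomial series. It is truncated at `N` because
non-resonance is only assumed up to a finite order. -/
theorem eq_coeff_oneSubPow (s : K) (c : ℕ → K) (N : ℕ) (h0 : c 0 = 1)
    (h : ∀ n < N, (n + 1 : K) * c (n + 1) = -s * ∑ i ∈ range (n + 1), c i) (n : ℕ) (hn : n ≤ N) :
    c n = PowerSeries.coeff n (oneSubPow s) := by
  induction n with
  | zero => rw [h0, coeff_zero_oneSubPow]
  | succ n ih =>
    have h1 : (n + 1 : K) ≠ 0 := by exact_mod_cast n.succ_ne_zero
    apply mul_left_cancel₀ h1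
    rw [succ_mul_coeff_oneSubPow, ← ih (by omega), h n hn, sum_range_succ]
    cases n with
    | zero => simp
    | succ n => rw [mul_add, ← h n (by omega)]; push_cast; ring

/-- The hypothesis is the differential equation of `(1 - u)^s` for `f / g`. Hence `f` divided by the
right-hand side has derivative zero and constant term one, so it is `1` in characteristic zero. -/
theorem eq_oneSubPow_mul {f g : PowerSeries K} (s : K) (hf : PowerSeries.coeff 0 f = 1)
    (hg : PowerSeries.coeff 0 g = 1)
    (h : (1 - PowerSeries.X) * (PowerSeries.derivative K f * g - f * PowerSeries.derivative K g) =
      PowerSeries.C (-s) * (f * g)) :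
    f = oneSubPow s * g := by
  have hp : (1 - PowerSeries.X) * PowerSeries.derivative K (oneSubPow s) =
      PowerSeries.C (-s) * oneSubPow s := by
    ext n
    rw [sub_mul, one_mul, map_sub, PowerSeries.coeff_derivative, PowerSeries.coeff_C_mul]
    cases n with
    | zero =>
      have := succ_mul_coeff_oneSubPow s 0
      simp at this ⊢
      exact this
    | succ n =>
      rw [PowerSeries.coeff_succ_X_mul, PowerSeries.coeff_derivative]
      have := succ_mul_coeff_oneSubPow s (n + 1)
      push_cast at this ⊢
      linear_combination this
  set q := oneSubPow s * g with hq
  have hq0 : PowerSeries.constantCoeff q = 1 := by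
    rw [hq, map_mul, ← PowerSeries.coeff_zero_eq_constantCoeff_apply,
      ← PowerSeries.coeff_zero_eq_constantCoeff_apply, coeff_zero_oneSubPow, hg, one_mul]
  have hX : (1 - PowerSeries.X : PowerSeries K) ≠ 0 := by
    intro e
    have := congrArg PowerSeries.constantCoeff e
    simp at this
  have key : PowerSeries.derivative K f * q = f * PowerSeries.derivative K q := by
    apply mul_left_cancel₀ hX
    rw [hq, Derivation.leibniz, smul_eq_mul, smul_eq_mul]
    linear_combination oneSubPow s * h - f * g * hp
  have hqi : q * q⁻¹ = 1 := PowerSeries.mul_inv_cancel q (by rw [hq0]; exact one_ne_zero)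
  have h1 : f * q⁻¹ = 1 := by
    apply PowerSeries.derivative.ext
    · rw [Derivation.leibniz, PowerSeries.derivative_inv', smul_eq_mul, smul_eq_mul]
      simp only [PowerSeries.derivative_one]
      linear_combination q⁻¹ ^ 2 * key - PowerSeries.derivative K f * q⁻¹ * hqi
    · rw [map_mul, PowerSeries.constantCoeff_inv, hq0,
        ← PowerSeries.coeff_zero_eq_constantCoeff_apply, hf]
      simp
  calc f = f * (q * q⁻¹) := by rw [hqi, mul_one]
    _ = (f * q⁻¹) * q := by ring
    _ = q := by rw [h1, one_mul]

end Series

/-! ### One-step recursion for the weights of (a) -/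

section Kajihara

variable {K : Type*} [Field K] {r : ℕ}

theorem poch_zero (x : K) : poch x 0 = 1 := by simp [poch]

theorem poch_succ (x : K) (k : ℕ) : poch x (k + 1) = poch x k * (x + k) := by
  simp [poch, ascPochhammer_succ_eval]

theorem vandermonde_insert {A : Finset (Fin r)} {α : Fin r} (hα : α ∉ A) (y : Fin r → K) :
    vandermonde (insert α A) y =
      (∏ β ∈ A, if α < β then (1 : K) else -1) * (∏ β ∈ A, (y α - y β)) * vandermonde A y := by
  simp only [vandermonde, prod_filter]
  rw [prod_insert hα, prod_insert hα, if_neg (lt_irrefl α), one_mul]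
  simp_rw [prod_insert hα]
  rw [prod_mul_distrib, ← mul_assoc]
  congr 1
  refine prod_mul_distrib.symm.trans (Eq.trans ?_ prod_mul_distrib)
  refine prod_congr rfl fun β hβ => ?_
  rcases lt_trichotomy α β with h | h | h
  · simp [h, h.not_gt]
  · exact absurd (h ▸ hβ) hα
  · simp [h, h.not_gt]

theorem vandermonde_congr {J : Finset (Fin r)} {y z : Fin r → K} (h : ∀ α ∈ J, y α = z α) :
    vandermonde J y = vandermonde J z := by
  unfold vandermonde
  refine prod_congr rfl fun α hα => prod_congr rfl fun β hβ => ?_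
  rw [h α hα, h β (mem_filter.1 hβ).1]

theorem vandermonde_ne_zero {J : Finset (Fin r)} {y : Fin r → K}
    (h : ∀ α ∈ J, ∀ β ∈ J, α ≠ β → y α ≠ y β) : vandermonde J y ≠ 0 :=
  prod_ne_zero_iff.2 fun α hα => prod_ne_zero_iff.2 fun β hβ =>
    sub_ne_zero.2 (h α hα β (mem_filter.1 hβ).1 (mem_filter.1 hβ).2.ne)

/-- Moving one coordinate changes only the factors that contain it, and their signs depend on the
order of the indices alone, so they cancel. -/
theorem vandermonde_mul_prod {J : Finset (Fin r)} {α : Fin r} (hα : α ∈ J) {y z : Fin r → K}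
    (h : ∀ β ∈ J, β ≠ α → z β = y β) :
    vandermonde J z * ∏ β ∈ J.erase α, (y α - y β) =
      vandermonde J y * ∏ β ∈ J.erase α, (z α - y β) := by
  obtain ⟨A, hA, rfl⟩ : ∃ A, α ∉ A ∧ J = insert α A :=
    ⟨J.erase α, by simp, (insert_erase hα).symm⟩
  have h' : ∀ β ∈ A, z β = y β := fun β hβ =>
    h β (mem_insert_of_mem hβ) fun e => hA (e ▸ hβ)
  have hz : ∏ β ∈ A, (z α - z β) = ∏ β ∈ A, (z α - y β) :=
    prod_congr rfl fun β hβ => by rw [h' β hβ]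
  rw [erase_insert hA, vandermonde_insert hA, vandermonde_insert hA, vandermonde_congr h', hz]
  ring

/-- The summand of the multiple hypergeometric series of Kajihara type attached to `J`. -/
noncomputable def kajiharaWeight (J : Finset (Fin r)) (x m : Fin r → K) (k : Fin r → ℕ) : K :=
  vandermonde J (fun α => x α + k α) / vandermonde J x *
    ∏ α ∈ J, ∏ β, poch (m β + x α) (k α) / poch (1 + x α - x β) (k α)

theorem kajiharaWeight_congr {J : Finset (Fin r)} (x m : Fin r → K) {k l : Fin r → ℕ}
    (h : ∀ α ∈ J, k α = l α) : kajiharaWeight J x m k = kajiharaWeight J x m l := by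
  unfold kajiharaWeight
  rw [vandermonde_congr (z := fun α => x α + l α) fun α hα => by simp [h α hα],
    prod_congr rfl fun α hα => by rw [h α hα]]

theorem kajiharaWeight_zero {J : Finset (Fin r)} {x : Fin r → K} (m : Fin r → K)
    (h : ∀ α ∈ J, ∀ β ∈ J, α ≠ β → x α ≠ x β) : kajiharaWeight J x m 0 = 1 := by
  simp [kajiharaWeight, poch_zero, div_self (vandermonde_ne_zero h)]

theorem kajiharaWeight_add_single {J : Finset (Fin r)} {x m : Fin r → K} {k : Fin r → ℕ}
    {α : Fin r} (hα : α ∈ J) (hne : ∀ γ, x α + k α + 1 - x γ ≠ 0) :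
    kajiharaWeight J x m (k + Pi.single α 1) *
        ((∏ β ∈ J.erase α, (x α + k α - (x β + k β))) * ∏ γ, (x α + k α + 1 - x γ)) =
      kajiharaWeight J x m k *
        ((∏ β ∈ J.erase α, (x α + k α + 1 - (x β + k β))) * ∏ γ, (x α + k α + m γ)) := by
  have hv := vandermonde_mul_prod hα (y := fun β => x β + (k β : K))
    (z := fun β => x β + ((k + Pi.single α 1 : Fin r → ℕ) β : K)) fun β _ h => by simp [h]
  have hp : (∏ β ∈ J, ∏ γ, poch (m γ + x β) ((k + Pi.single α 1 : Fin r → ℕ) β) /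
        poch (1 + x β - x γ) ((k + Pi.single α 1 : Fin r → ℕ) β)) *
      ∏ γ, (x α + k α + 1 - x γ) =
      (∏ β ∈ J, ∏ γ, poch (m γ + x β) (k β) / poch (1 + x β - x γ) (k β)) *
        ∏ γ, (x α + k α + m γ) := by
    rw [← mul_prod_erase J _ hα, ← mul_prod_erase J _ hα,
      prod_congr (s₁ := J.erase α) rfl fun β hβ => by
        rw [show (k + Pi.single α 1 : Fin r → ℕ) β = k β by simp [(mem_erase.1 hβ).1]],
      mul_right_comm, mul_right_comm _ _ (∏ γ, (x α + k α + m γ)), ← prod_mul_distrib,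
      ← prod_mul_distrib]
    congr 1
    refine prod_congr rfl fun γ _ => ?_
    have h1 := hne γ
    rw [show (k + Pi.single α 1 : Fin r → ℕ) α = k α + 1 by simp, poch_succ, poch_succ,
      show 1 + x α - x γ + k α = x α + k α + 1 - x γ by ring, mul_div_mul_comm, mul_assoc,
      div_mul_cancel₀ _ h1]
    ring
  unfold kajiharaWeight
  simp only [Pi.add_apply, Pi.single_eq_same, Nat.cast_add, Nat.cast_one] at hv hp ⊢
  rw [show x α + ((k α : K) + 1) = x α + k α + 1 by ring] at hv
  linear_combination (∏ β ∈ J, ∏ γ, poch (m γ + x β) (k β) / poch (1 + x β - x γ) (k β)) *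
    (∏ γ, (x α + k α + m γ)) / vandermonde J x * hv +
    vandermonde J (fun β => x β + ((k β : K) + (Pi.single α 1 : Fin r → ℕ) β)) *
      (∏ β ∈ J.erase α, (x α + k α - (x β + k β))) / vandermonde J x * hp

/-- Off `J` the values of `y` are free: the factor `y α + 1 - y δ` occurs in both denominators
there, since the right-hand pole is `y δ - 1`. This freedom lets the lemma serve `I` with `y` and
`J` with `-y`. -/
theorem kajiharaWeight_mul_residue {J : Finset (Fin r)} {x m y : Fin r → K} {k : Fin r → ℕ}
    {α : Fin r} (hα : α ∈ J) (hy : ∀ β ∈ J, y β = x β + k β)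
    (h1 : ∀ γ, y α + 1 - x γ ≠ 0) (h2 : ∀ γ ≠ α, y α + 1 ≠ y γ)
    (h3 : ∀ β ∈ J, β ≠ α → y α ≠ y β) :
    kajiharaWeight J x m (k + Pi.single α 1) *
        ((y α + 1 - x α) * ∏ δ ∈ univ.erase α, ((y α + 1 - x δ) / (y α + 1 - y δ))) =
      kajiharaWeight J x m k *
        ((y α + m α) *
          ∏ δ ∈ univ.erase α, ((y α + m δ) / (y α - if δ ∈ J then y δ else y δ - 1))) := by
  have key := kajiharaWeight_add_single (m := m) (k := k) hα fun γ => by rw [← hy α hα]; exact h1 γ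
  rw [← hy α hα, prod_congr (s₁ := J.erase α) rfl fun β hβ => by
      rw [← hy β (mem_of_mem_erase hβ)],
    prod_congr (s₁ := J.erase α) (f := fun β => y α + 1 - (x β + k β)) rfl fun β hβ => by
      rw [← hy β (mem_of_mem_erase hβ)]] at key
  have hunion : (univ.erase α : Finset (Fin r)) = J.erase α ∪ Jᶜ := by
    ext δ
    by_cases hδ : δ ∈ J
    · simp [hδ]
    · simp [hδ, show δ ≠ α from fun e => hδ (e ▸ hα)]
  have hdis : Disjoint (J.erase α) Jᶜ :=
    disjoint_left.2 fun δ h h' => (mem_compl.1 h') (mem_of_mem_erase h)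
  have e1 : (y α + 1 - x α) * ∏ δ ∈ univ.erase α, ((y α + 1 - x δ) / (y α + 1 - y δ)) =
      (∏ γ, (y α + 1 - x γ)) / ((∏ δ ∈ J.erase α, (y α + 1 - y δ)) * ∏ δ ∈ Jᶜ, (y α + 1 - y δ)) := by
    rw [prod_div_distrib, ← prod_union hdis, ← hunion, ← mul_prod_erase univ _ (mem_univ α),
      mul_div_assoc]
  have e2 : (y α + m α) * ∏ δ ∈ univ.erase α, ((y α + m δ) / (y α - if δ ∈ J then y δ else y δ - 1)) =
      (∏ γ, (y α + m γ)) / ((∏ δ ∈ J.erase α, (y α - y δ)) * ∏ δ ∈ Jᶜ, (y α + 1 - y δ)) := by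
    rw [prod_div_distrib, ← mul_prod_erase univ _ (mem_univ α), mul_div_assoc]
    congr 2
    rw [hunion, prod_union hdis]
    congr 1
    · exact prod_congr rfl fun δ hδ => by rw [if_pos (mem_of_mem_erase hδ)]
    · exact prod_congr rfl fun δ hδ => by rw [if_neg (mem_compl.1 hδ)]; ring
  have n1 : ∏ δ ∈ J.erase α, (y α + 1 - y δ) ≠ 0 :=
    prod_ne_zero_iff.2 fun δ hδ => sub_ne_zero.2 (h2 δ (mem_erase.1 hδ).1)
  have n2 : ∏ δ ∈ Jᶜ, (y α + 1 - y δ) ≠ 0 :=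
    prod_ne_zero_iff.2 fun δ hδ => sub_ne_zero.2 (h2 δ fun e => (mem_compl.1 hδ) (e ▸ hα))
  have n3 : ∏ δ ∈ J.erase α, (y α - y δ) ≠ 0 :=
    prod_ne_zero_iff.2 fun δ hδ => sub_ne_zero.2 (h3 δ (mem_erase.1 hδ).2 (mem_erase.1 hδ).1)
  rw [e1, e2, mul_div_assoc', mul_div_assoc', div_eq_div_iff (mul_ne_zero n1 n2) (mul_ne_zero n3 n2)]
  linear_combination (∏ δ ∈ Jᶜ, (y α + 1 - y δ)) * key

end Kajihara

/-! ### The Euler operator on multi-index series -/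

section Derivative

variable {K : Type*} [Field K] {r : ℕ}

theorem X_mul_derivative_multiSeries (J : Finset (Fin r)) (c : (Fin r → ℕ) → K) :
    PowerSeries.X * PowerSeries.derivative K (multiSeries J c) =
      multiSeries J fun k => (∑ i ∈ J, (k i : K)) * c k := by
  ext n
  cases n with
  | zero => simp [multiSeries]
  | succ n =>
    rw [PowerSeries.coeff_succ_X_mul, PowerSeries.coeff_derivative]
    simp only [multiSeries, PowerSeries.coeff_mk]
    rw [sum_mul]
    refine sum_congr rfl fun k hk => ?_
    have := (mem_piAntidiag.1 hk).1
    rw [mul_comm, ← Nat.cast_sum, this]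
    push_cast
    rfl

theorem multiSeries_congr {J : Finset (Fin r)} {c d : (Fin r → ℕ) → K} (h : ∀ k, c k = d k) :
    multiSeries J c = multiSeries J d := by
  rw [funext h]

end Derivative

/-! ### Proof of (a): the differential equation for the quotient -/

section KajiharaTransformation

variable {K : Type*} [Field K] [CharZero K] {r : ℕ}

theorem multiSeries_kajiharaWeight {I J : Finset (Fin r)} (hd : Disjoint I J)
    (hu : I ∪ J = univ) (x m : Fin r → K)
    (hI : ∀ α ∈ I, ∀ β ∈ I, α ≠ β → ∀ n : ℤ, x α - x β ≠ n)
    (hJ : ∀ α ∈ J, ∀ β ∈ J, α ≠ β → ∀ n : ℤ, x α - x β ≠ n)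
    (hIJ : ∀ α ∈ J, ∀ β ∈ I, ∀ n : ℕ, x α - x β ≠ n + 1) :
    multiSeries I (kajiharaWeight I x m) =
      oneSubPow (-(∑ α, (x α + m α)) + #J) *
        multiSeries J (kajiharaWeight J (-x) (1 - m)) := by
  have hmem : ∀ γ, γ ∈ J ↔ γ ∉ I := fun γ =>
    ⟨fun h h' => disjoint_left.1 hd h' h, fun h => by
      have := mem_univ γ; rw [← hu, mem_union] at this; exact this.resolve_left h⟩
  set W : (Fin r → ℕ) → K := fun κ => kajiharaWeight I x m κ * kajiharaWeight J (-x) (1 - m) κ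
    with hW
  let σ : Fin r → K := fun γ => if γ ∈ I then 1 else -1
  let y : (Fin r → ℕ) → Fin r → K := fun κ γ => x γ + σ γ * κ γ
  let P : (Fin r → ℕ) → Fin r → K := fun κ γ => if γ ∈ I then y κ γ else y κ γ - 1
  have yI : ∀ κ, ∀ γ ∈ I, y κ γ = x γ + κ γ := fun κ γ h => by simp [y, σ, h]
  have yJ : ∀ κ, ∀ γ ∈ J, y κ γ = x γ - κ γ := fun κ γ h => by
    simp [y, σ, (hmem γ).1 h, sub_eq_add_neg]
  have sameI : ∀ κ, ∀ n : ℤ, ∀ γ ∈ I, ∀ δ ∈ I, γ ≠ δ → y κ γ - y κ δ ≠ n := by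
    intro κ n γ hγ δ hδ h e
    rw [yI κ γ hγ, yI κ δ hδ] at e
    refine hI γ hγ δ hδ h (n - κ γ + κ δ) ?_
    push_cast
    linear_combination e
  have sameJ : ∀ κ, ∀ n : ℤ, ∀ γ ∈ J, ∀ δ ∈ J, γ ≠ δ → y κ γ - y κ δ ≠ n := by
    intro κ n γ hγ δ hδ h e
    rw [yJ κ γ hγ, yJ κ δ hδ] at e
    refine hJ γ hγ δ hδ h (n + κ γ - κ δ) ?_
    push_cast
    linear_combination e
  have mixed : ∀ κ, ∀ n : ℕ, ∀ γ ∈ I, ∀ δ ∈ J, y κ γ - y κ δ + n = 0 → κ γ + κ δ + n = 0 := by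
    intro κ n γ hγ δ hδ e
    rw [yI κ γ hγ, yJ κ δ hδ] at e
    by_contra hc
    obtain ⟨p, hp⟩ := Nat.exists_eq_succ_of_ne_zero hc
    refine hIJ δ hδ γ hγ p ?_
    have : ((κ γ + κ δ + n : ℕ) : K) = p + 1 := by rw [hp]; push_cast; rfl
    rw [← this]
    push_cast
    linear_combination -e
  -- The condition `κ γ ≠ 0` is essential: `x γ = x δ` is allowed across `I` and `J`, so two unmoved
  -- points may coincide. Subtracting `1` on `J` removes this exception for `P` below.
  have yne : ∀ κ γ δ, γ ≠ δ → κ γ ≠ 0 → y κ γ ≠ y κ δ := by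
    intro κ γ δ h h0 e
    by_cases hγ : γ ∈ I <;> by_cases hδ : δ ∈ I
    · exact sameI κ 0 γ hγ δ hδ h (by simp [e])
    · have := mixed κ 0 γ hγ δ ((hmem δ).2 hδ) (by simp [e])
      omega
    · have := mixed κ 0 δ hδ γ ((hmem γ).2 hγ) (by simp [e])
      omega
    · exact sameJ κ 0 γ ((hmem γ).2 hγ) δ ((hmem δ).2 hδ) h (by simp [e])
  have Pne : ∀ κ γ δ, γ ≠ δ → P κ γ ≠ P κ δ := by
    intro κ γ δ h e
    by_cases hγ : γ ∈ I <;> by_cases hδ : δ ∈ I <;> simp only [P, hγ, hδ, if_true, if_false] at e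
    · exact sameI κ 0 γ hγ δ hδ h (by simp [e])
    · have := mixed κ 1 γ hγ δ ((hmem δ).2 hδ) (by simp [e])
      omega
    · have := mixed κ 1 δ hδ γ ((hmem γ).2 hγ) (by simp [← e])
      omega
    · exact sameJ κ 0 γ ((hmem γ).2 hγ) δ ((hmem δ).2 hδ) h
        (by rw [sub_left_inj] at e; simp [e])
  let Q : (Fin r → ℕ) → Fin r → K := fun κ γ =>
    (y κ γ - x γ) * ∏ δ ∈ univ.erase γ, ((y κ γ - x δ) / (y κ γ - y κ δ))
  have hQ : ∀ κ : Fin r → ℕ, ∑ γ with κ γ ≠ 0, Q κ γ = ∑ γ, σ γ * κ γ := by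
    intro κ
    have h1 := sum_residues (univ.filter fun γ => κ γ ≠ 0) x (y κ) (by
      intro γ hγ δ _ e
      by_contra h
      exact yne κ γ δ h (by simpa using hγ) e)
    have h2 : ∑ γ with κ γ ≠ 0, (y κ γ - x γ) = ∑ γ, σ γ * κ γ := by
      rw [sum_filter]
      refine sum_congr rfl fun γ _ => ?_
      by_cases h : κ γ = 0 <;> simp [y, h]
    rw [← h2, ← h1]
    -- Where `κ δ = 0` the zero `x δ` cancels the pole `y κ δ`, so the product over all indices
    -- equals the one over the support of `κ`.
    refine sum_congr rfl fun γ hγ => ?_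
    simp only [Q]
    congr 1
    symm
    refine prod_subset (fun δ hδ => by simpa using (mem_erase.1 hδ).1) fun δ hδ hδ' => ?_
    have hδ0 : κ δ = 0 := by
      by_contra h
      exact hδ' (by simp [h, (mem_erase.1 hδ).1])
    have : y κ δ = x δ := by simp [y, hδ0]
    rw [← this, div_self]
    exact sub_ne_zero.2 (yne κ γ δ (mem_erase.1 hδ).1.symm (by simpa using hγ))
  have step : ∀ κ γ, W (κ + Pi.single γ 1) * Q (κ + Pi.single γ 1) γ =
      W κ * ((P κ γ - -m γ) * ∏ δ ∈ univ.erase γ, ((P κ γ - -m δ) / (P κ γ - P κ δ))) := by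
    intro κ γ
    set κ' : Fin r → ℕ := κ + Pi.single γ 1 with hκ'
    have k0 : κ' γ ≠ 0 := by simp [hκ']
    have kne : ∀ δ, δ ≠ γ → κ' δ = κ δ := fun δ h => by simp [hκ', h]
    have y' : ∀ δ, δ ≠ γ → y κ' δ = y κ δ := fun δ h => by simp [y, kne δ h]
    have xne : ∀ δ, y κ' γ - x δ ≠ 0 := by
      intro δ e
      by_cases hδ : δ = γ
      · subst hδ
        by_cases hI : δ ∈ I
        · rw [yI _ _ hI] at e; simp [k0] at e
        · rw [yJ _ _ ((hmem δ).2 hI)] at e; simp [k0] at e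
      -- Distinctness is applied to the multi-index supported at `γ` alone, for which the point of
      -- index `δ` is still `x δ`.
      · have h := yne (Pi.single γ (κ' γ)) γ δ (Ne.symm hδ) (by simp [k0])
        refine h ?_
        have e2 : y (Pi.single γ (κ' γ)) δ = x δ := by simp [y, hδ]
        have e3 : y (Pi.single γ (κ' γ)) γ = y κ' γ := by simp [y]
        rw [e2, e3]
        exact sub_eq_zero.1 e
    by_cases hγ : γ ∈ I
    · have e1 : y κ' γ = y κ γ + 1 := by
        rw [yI _ _ hγ, yI _ _ hγ]; simp [hκ']; ring
      have h := kajiharaWeight_mul_residue (J := I) (x := x) (m := m) (y := y κ) (k := κ) hγ (yI κ)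
        (fun δ => by rw [← e1]; exact xne δ)
        (fun δ hδ => by rw [← e1, ← y' δ hδ]; exact yne κ' γ δ (Ne.symm hδ) k0)
        (fun δ hδ h e => sameI κ 0 γ hγ δ hδ (Ne.symm h) (by simp [e]))
      have e2 : Q κ' γ = (y κ γ + 1 - x γ) *
          ∏ δ ∈ univ.erase γ, ((y κ γ + 1 - x δ) / (y κ γ + 1 - y κ δ)) := by
        simp only [Q]
        rw [e1]
        congr 1
        exact prod_congr rfl fun δ hδ => by rw [y' δ (mem_erase.1 hδ).1]
      have e3 : P κ γ = y κ γ := by simp [P, hγ]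
      have e4 : kajiharaWeight J (-x) (1 - m) κ' = kajiharaWeight J (-x) (1 - m) κ :=
        kajiharaWeight_congr _ _ fun δ hδ => kne δ fun e => (hmem δ).1 hδ (e ▸ hγ)
      rw [hW]
      simp only [sub_neg_eq_add]
      rw [e2, e4, e3]
      linear_combination kajiharaWeight J (-x) (1 - m) κ * h
    · have hγ' := (hmem γ).2 hγ
      have e1 : y κ' γ = y κ γ - 1 := by
        rw [yJ _ _ hγ', yJ _ _ hγ']; simp [hκ']; ring
      -- Reflection `z ↦ -z` turns the downward step on `J` into an upward one; both residues change
      -- sign.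
      have h := kajiharaWeight_mul_residue (J := J) (x := -x) (m := 1 - m) (y := -y κ) (k := κ) hγ'
        (fun δ hδ => by rw [Pi.neg_apply, yJ κ δ hδ, Pi.neg_apply]; ring)
        (fun δ e => xne δ (by rw [e1]; simp only [Pi.neg_apply] at e; linear_combination -e))
        (fun δ hδ e => yne κ' γ δ (Ne.symm hδ) k0
          (by rw [e1, y' δ hδ]; simp only [Pi.neg_apply] at e; linear_combination -e))
        (fun δ hδ h e => sameJ κ 0 γ hγ' δ hδ (Ne.symm h)
          (by simp only [Pi.neg_apply, neg_inj] at e; simp [e]))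
      have e2 : Q κ' γ = -((-y κ γ + 1 - -x γ) *
          ∏ δ ∈ univ.erase γ, ((-y κ γ + 1 - -x δ) / (-y κ γ + 1 - -y κ δ))) := by
        simp only [Q]
        rw [e1, ← neg_mul]
        congr 1
        · ring
        · refine prod_congr rfl fun δ hδ => ?_
          rw [y' δ (mem_erase.1 hδ).1, ← neg_div_neg_eq]
          congr 1 <;> ring
      have e3 : (P κ γ - -m γ) * ∏ δ ∈ univ.erase γ, ((P κ γ - -m δ) / (P κ γ - P κ δ)) =
          -((-y κ γ + (1 - m γ)) * ∏ δ ∈ univ.erase γ, ((-y κ γ + (1 - m δ)) /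
            (-y κ γ - if δ ∈ J then -y κ δ else -y κ δ - 1))) := by
        rw [← neg_mul]
        congr 1
        · simp [P, hγ]; ring
        · refine prod_congr rfl fun δ hδ => ?_
          rw [← neg_div_neg_eq]
          congr 1
          · simp [P, hγ]; ring
          · by_cases h : δ ∈ I
            · simp [P, hγ, h, hmem]; ring
            · simp [P, hγ, h, hmem]; ring
      have e4 : kajiharaWeight I x m κ' = kajiharaWeight I x m κ :=
        kajiharaWeight_congr _ _ fun δ hδ => kne δ fun e => hγ (e ▸ hδ)
      simp only [Pi.neg_apply, Pi.sub_apply, Pi.one_apply] at h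
      rw [hW]
      simp only
      rw [e2, e4, e3]
      linear_combination -kajiharaWeight I x m κ * h
  set A : K := ∑ α, (x α + m α) with hA
  have hP : ∀ κ : Fin r → ℕ, ∑ γ, (P κ γ - -m γ) = (A - #J) + ∑ γ, σ γ * κ γ := by
    intro κ
    have : ∀ γ, P κ γ - -m γ = (x γ + m γ) + σ γ * κ γ - if γ ∈ J then 1 else 0 := by
      intro γ
      by_cases h : γ ∈ I
      · simp [P, y, h, hmem]; ring
      · simp [P, y, h, hmem]; ring
    simp_rw [this, sum_sub_distrib, sum_add_distrib]
    rw [hA, sum_add_distrib]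
    simp
    ring
  set L := multiSeries I (kajiharaWeight I x m)
  set R := multiSeries J (kajiharaWeight J (-x) (1 - m))
  have hLR : L * R = multiSeries univ W := by
    rw [← hu]
    exact multiSeries_mul hd _ _ (fun k l h => kajiharaWeight_congr _ _ h)
      (fun k l h => kajiharaWeight_congr _ _ h)
  have hF : PowerSeries.X * (PowerSeries.derivative K L * R - L * PowerSeries.derivative K R) =
      multiSeries univ fun κ => W κ * ∑ γ, σ γ * κ γ := by
    have h1 : (PowerSeries.X * PowerSeries.derivative K L) * R =
        multiSeries univ fun κ => ((∑ i ∈ I, (κ i : K)) * kajiharaWeight I x m κ) *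
          kajiharaWeight J (-x) (1 - m) κ := by
      rw [X_mul_derivative_multiSeries, ← hu]
      exact multiSeries_mul hd _ _ (fun k l h => by
        rw [kajiharaWeight_congr _ _ h, sum_congr rfl fun i hi => by rw [h i hi]])
        (fun k l h => kajiharaWeight_congr _ _ h)
    have h2 : L * (PowerSeries.X * PowerSeries.derivative K R) =
        multiSeries univ fun κ => kajiharaWeight I x m κ *
          ((∑ i ∈ J, (κ i : K)) * kajiharaWeight J (-x) (1 - m) κ) := by
      rw [X_mul_derivative_multiSeries, ← hu]
      exact multiSeries_mul hd _ _ (fun k l h => kajiharaWeight_congr _ _ h) (fun k l h => by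
        rw [kajiharaWeight_congr _ _ h, sum_congr rfl fun i hi => by rw [h i hi]])
    have h3 : PowerSeries.X * (PowerSeries.derivative K L * R - L * PowerSeries.derivative K R) =
        (PowerSeries.X * PowerSeries.derivative K L) * R -
          L * (PowerSeries.X * PowerSeries.derivative K R) := by ring
    rw [h3, h1, h2]
    ext n
    simp only [multiSeries, map_sub, PowerSeries.coeff_mk, ← sum_sub_distrib]
    refine sum_congr rfl fun κ _ => ?_
    have : ∑ γ, σ γ * κ γ = ∑ i ∈ I, (κ i : K) - ∑ i ∈ J, (κ i : K) := by
      rw [← hu, sum_union hd, sub_eq_add_neg, ← sum_neg_distrib]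
      congr 1
      · exact sum_congr rfl fun i hi => by simp [σ, hi]
      · exact sum_congr rfl fun i hi => by simp [σ, (hmem i).1 hi]
    rw [this, hW]
    ring
  -- With `F = u (L' R - L R')` this says `(1 - u) F = (A - #J) u L R` in positive degrees: one
  -- residue sum evaluates the left side, `step` lowers the degree, and the other residue sum
  -- evaluates the right side.
  have hrec : ∀ N, PowerSeries.coeff (N + 1) (multiSeries univ fun κ => W κ * ∑ γ, σ γ * κ γ) =
      (A - #J) * PowerSeries.coeff N (multiSeries univ W) +
        PowerSeries.coeff N (multiSeries univ fun κ => W κ * ∑ γ, σ γ * κ γ) := by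
    intro N
    simp only [multiSeries, PowerSeries.coeff_mk]
    simp_rw [← hQ, mul_sum (s := univ.filter _)]
    rw [sum_piAntidiag_succ univ N fun γ κ => W κ * Q κ γ, mul_sum, ← sum_add_distrib]
    refine sum_congr rfl fun κ _ => ?_
    rw [sum_congr rfl fun γ _ => step κ γ, ← mul_sum, sum_residues _ _ _ fun γ _ δ _ e =>
      by_contra fun h => Pne κ γ δ h e, hP, ← mul_sum, hQ]
    ring
  have hI0 : ∀ α ∈ I, ∀ β ∈ I, α ≠ β → x α ≠ x β := fun α hα β hβ h e =>
    hI α hα β hβ h 0 (by simp [e])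
  have hJ0 : ∀ α ∈ J, ∀ β ∈ J, α ≠ β → (-x) α ≠ (-x) β := fun α hα β hβ h e =>
    hJ α hα β hβ h 0 (by simp only [Pi.neg_apply, neg_inj] at e; simp [e])
  apply eq_oneSubPow_mul
  · simp [L, multiSeries, kajiharaWeight_zero m hI0]
  · simp [R, multiSeries, kajiharaWeight_zero (1 - m) hJ0]
  · apply mul_left_cancel₀ (PowerSeries.X_ne_zero (R := K))
    rw [mul_left_comm, hF, hLR]
    ext n
    cases n with
    | zero => simp [multiSeries, sub_mul]
    | succ n =>
      rw [sub_mul, one_mul, map_sub, PowerSeries.coeff_succ_X_mul, PowerSeries.coeff_succ_X_mul,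
        hrec, PowerSeries.coeff_C_mul]
      ring

end KajiharaTransformation

/-! ### Rational functions regular at a point -/

section RegularAt

open Polynomial

variable {K : Type*} [Field K]

/-- `f` agrees with a quotient of two polynomials wherever the denominator does not vanish, and the
denominator does not vanish at `z`. -/
def RegularAt (z : K) (f : K → K) : Prop :=
  ∃ P Q : K[X], Q.eval z ≠ 0 ∧ ∀ t, Q.eval t ≠ 0 → f t * Q.eval t = P.eval t

theorem RegularAt.const (z c : K) : RegularAt z fun _ => c :=
  ⟨C c, 1, by simp, by simp⟩

theorem RegularAt.id (z : K) : RegularAt z fun t => t :=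
  ⟨X, 1, by simp, by simp⟩

theorem RegularAt.add {z : K} {f g : K → K} (hf : RegularAt z f) (hg : RegularAt z g) :
    RegularAt z fun t => f t + g t := by
  obtain ⟨P, Q, hQ, h⟩ := hf
  obtain ⟨P', Q', hQ', h'⟩ := hg
  refine ⟨P * Q' + P' * Q, Q * Q', by simp [hQ, hQ'], fun t ht => ?_⟩
  simp only [eval_mul, eval_add, ne_eq, mul_eq_zero, not_or] at ht ⊢
  rw [← h t ht.1, ← h' t ht.2]
  ring

theorem RegularAt.mul {z : K} {f g : K → K} (hf : RegularAt z f) (hg : RegularAt z g) :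
    RegularAt z fun t => f t * g t := by
  obtain ⟨P, Q, hQ, h⟩ := hf
  obtain ⟨P', Q', hQ', h'⟩ := hg
  refine ⟨P * P', Q * Q', by simp [hQ, hQ'], fun t ht => ?_⟩
  simp only [eval_mul, ne_eq, mul_eq_zero, not_or] at ht ⊢
  rw [← h t ht.1, ← h' t ht.2]
  ring

theorem RegularAt.sub {z : K} {f g : K → K} (hf : RegularAt z f) (hg : RegularAt z g) :
    RegularAt z fun t => f t - g t := by
  have := hf.add ((RegularAt.const z (-1)).mul hg)
  simpa [sub_eq_add_neg] using this

theorem RegularAt.inv {z : K} {f : K → K} (hf : RegularAt z f) (h0 : f z ≠ 0) :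
    RegularAt z fun t => (f t)⁻¹ := by
  obtain ⟨P, Q, hQ, h⟩ := hf
  have hP : P.eval z ≠ 0 := by rw [← h z hQ]; exact mul_ne_zero h0 hQ
  refine ⟨Q * Q, P * Q, by simp [hQ, hP], fun t ht => ?_⟩
  simp only [eval_mul, ne_eq, mul_eq_zero, not_or] at ht ⊢
  have hft : f t ≠ 0 := fun e => ht.1 (by rw [← h t ht.2, e, zero_mul])
  rw [← h t ht.2]
  field_simp

theorem RegularAt.div {z : K} {f g : K → K} (hf : RegularAt z f) (hg : RegularAt z g)
    (h0 : g z ≠ 0) : RegularAt z fun t => f t / g t := by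
  simpa only [div_eq_mul_inv] using hf.mul (hg.inv h0)

theorem RegularAt.sum {ι : Type*} {z : K} (s : Finset ι) {f : ι → K → K}
    (h : ∀ i ∈ s, RegularAt z (f i)) : RegularAt z fun t => ∑ i ∈ s, f i t := by
  classical
  induction s using Finset.induction_on with
  | empty => simpa using RegularAt.const z 0
  | insert a s ha ih =>
    simp only [sum_insert ha]
    exact (h a (mem_insert_self a s)).add (ih fun i hi => h i (mem_insert_of_mem hi))

theorem RegularAt.prod {ι : Type*} {z : K} (s : Finset ι) {f : ι → K → K}
    (h : ∀ i ∈ s, RegularAt z (f i)) : RegularAt z fun t => ∏ i ∈ s, f i t := by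
  classical
  induction s using Finset.induction_on with
  | empty => simpa using RegularAt.const z 1
  | insert a s ha ih =>
    simp only [prod_insert ha]
    exact (h a (mem_insert_self a s)).mul (ih fun i hi => h i (mem_insert_of_mem hi))

theorem poch_eq_prod (x : K) (k : ℕ) : poch x k = ∏ i ∈ range k, (x + i) := by
  induction k with
  | zero => simp [poch_zero]
  | succ k ih => rw [poch_succ, ih, prod_range_succ]

theorem poch_ne_zero {x : K} {k : ℕ} (h : ∀ i < k, x + i ≠ 0) : poch x k ≠ 0 := by
  rw [poch_eq_prod]
  exact prod_ne_zero_iff.2 fun i hi => h i (mem_range.1 hi)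

theorem RegularAt.poch {z : K} {f : K → K} (hf : RegularAt z f) (k : ℕ) :
    RegularAt z fun t => poch (f t) k := by
  simp only [poch_eq_prod]
  exact RegularAt.prod _ fun i _ => hf.add (RegularAt.const z _)

/-- The numerator of `f - g` vanishes off a finite set, hence identically, and the denominator is
nonzero at `z`. This extends identities from generic parameters. -/
theorem RegularAt.eq_of_finite [Infinite K] {z : K} {f g : K → K} (hf : RegularAt z f)
    (hg : RegularAt z g) {s : Set K} (hs : s.Finite) (h : ∀ t ∉ s, f t = g t) : f z = g z := by
  obtain ⟨P, Q, hQ, hPQ⟩ := hf.sub hg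
  have hQ0 : Q ≠ 0 := fun e => hQ (by simp [e])
  have hP : P = 0 := by
    by_contra hP
    have hfin : (s ∪ {t | Q.IsRoot t} ∪ {t | P.IsRoot t}).Finite :=
      (hs.union (finite_setOfPred_isRoot hQ0)).union (finite_setOfPred_isRoot hP)
    obtain ⟨t, ht⟩ := hfin.exists_notMem
    simp only [Set.mem_union, Set.mem_ofPred_eq, IsRoot, not_or] at ht
    refine ht.2 ?_
    rw [← hPQ t ht.1.2]
    simp [h t ht.1.1]
  have := hPQ z hQ
  rw [hP, eval_zero, mul_eq_zero] at this
  exact sub_eq_zero.1 (this.resolve_right hQ)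

end RegularAt

/-! ### The weights of (b) and their denominators -/

section SourceWeight

variable {K ι : Type*} [Field K]

/-- The summand of the source identity attached to the pair `(I, J)`. -/
noncomputable def sourceWeight (I J : Finset ι) (x : ι → K) (θ : K) (k : ι → ℕ) : K :=
  (∏ β ∈ I, ∏ α ∈ I, poch (x α - x β - θ - k β) (k α) / poch (x α - x β - k β) (k α)) *
    ∏ β ∈ I, ∏ α ∈ J, poch (x α - x β - θ - k β) (k β) / poch (x α - x β - k β) (k β)

theorem sourceWeight_zero (I J : Finset ι) (x : ι → K) (θ : K) : sourceWeight I J x θ 0 = 1 := by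
  simp [sourceWeight, poch_zero]

/-- No summand of order at most `n` of the source identity for `(I, J)` has a vanishing
denominator. -/
structure NonResonant (I J : Finset ι) (x : ι → K) (n : ℕ) : Prop where
  left : ∀ α ∈ I, ∀ β ∈ I, α ≠ β → ∀ m : ℤ, |m| ≤ n → x α - x β ≠ m
  right : ∀ α ∈ J, ∀ β ∈ J, α ≠ β → ∀ m : ℤ, |m| ≤ n → x α - x β ≠ m
  mixed : ∀ α ∈ J, ∀ β ∈ I, ∀ m : ℕ, m < n → x α - x β ≠ m + 1

theorem NonResonant.neg {I J : Finset ι} {x : ι → K} {n : ℕ} (h : NonResonant I J x n) :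
    NonResonant J I (-x) n where
  left α hα β hβ hne m hm e := h.right α hα β hβ hne (-m) (by rwa [abs_neg]) (by
    simp only [Pi.neg_apply] at e; push_cast; linear_combination -e)
  right α hα β hβ hne m hm e := h.left α hα β hβ hne (-m) (by rwa [abs_neg]) (by
    simp only [Pi.neg_apply] at e; push_cast; linear_combination -e)
  mixed α hα β hβ m hm e := h.mixed β hβ α hα m hm (by
    simp only [Pi.neg_apply] at e; linear_combination e)

theorem NonResonant.mono {I J : Finset ι} {x : ι → K} {m n : ℕ} (h : NonResonant I J x n)
    (hmn : m ≤ n) : NonResonant I J x m where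
  left α hα β hβ hne l hl := h.left α hα β hβ hne l (hl.trans (by exact_mod_cast hmn))
  right α hα β hβ hne l hl := h.right α hα β hβ hne l (hl.trans (by exact_mod_cast hmn))
  mixed α hα β hβ l hl := h.mixed α hα β hβ l (hl.trans_le hmn)

variable [CharZero K]

theorem NonResonant.poch_left_ne_zero {I J : Finset ι} {x : ι → K} {n : ℕ}
    (h : NonResonant I J x n) {k : ι → ℕ} (hk : ∀ α ∈ I, k α ≤ n) {α β : ι} (hα : α ∈ I)
    (hβ : β ∈ I) : poch (x α - x β - k β) (k α) ≠ 0 := by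
  refine poch_ne_zero fun i hi e => ?_
  by_cases hne : α = β
  · subst hne
    have : (i : K) = k α := by linear_combination e
    exact hi.ne (by exact_mod_cast this)
  · refine h.left α hα β hβ hne (k β - i) ?_ (by push_cast; linear_combination e)
    have := hk α hα
    have := hk β hβ
    rw [abs_le]
    omega

omit [CharZero K] in
theorem NonResonant.poch_mixed_ne_zero {I J : Finset ι} {x : ι → K} {n : ℕ}
    (h : NonResonant I J x n) {k : ι → ℕ} (hk : ∀ α ∈ I, k α ≤ n) {α β : ι} (hα : α ∈ J)
    (hβ : β ∈ I) : poch (x α - x β - k β) (k β) ≠ 0 := by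
  refine poch_ne_zero fun i hi e => ?_
  have := hk β hβ
  refine h.mixed α hα β hβ (k β - i - 1) (by omega) ?_
  have : ((k β - i - 1 : ℕ) : K) + 1 = k β - i := by
    rw [← Nat.cast_add_one, show k β - i - 1 + 1 = k β - i by omega, Nat.cast_sub hi.le]
  rw [this]
  linear_combination e

theorem RegularAt.sourceWeight {I J : Finset ι} {z : K} {x : ι → K → K} {θ : K → K} {k : ι → ℕ}
    {n : ℕ} (h : NonResonant I J (fun α => x α z) n) (hk : ∀ α ∈ I, k α ≤ n)
    (hx : ∀ α, RegularAt z (x α)) (hθ : RegularAt z θ) :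
    RegularAt z fun t => sourceWeight I J (fun α => x α t) (θ t) k := by
  refine RegularAt.mul ?_ ?_
  · refine RegularAt.prod _ fun β hβ => RegularAt.prod _ fun α hα => RegularAt.div ?_ ?_ ?_
    · exact ((((hx α).sub (hx β)).sub hθ).sub (RegularAt.const z _)).poch _
    · exact (((hx α).sub (hx β)).sub (RegularAt.const z _)).poch _
    · exact h.poch_left_ne_zero hk hα hβ
  · refine RegularAt.prod _ fun β hβ => RegularAt.prod _ fun α hα => RegularAt.div ?_ ?_ ?_
    · exact ((((hx α).sub (hx β)).sub hθ).sub (RegularAt.const z _)).poch _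
    · exact (((hx α).sub (hx β)).sub (RegularAt.const z _)).poch _
    · exact h.poch_mixed_ne_zero hk hα hβ

end SourceWeight

/-! ### Closed form of the sum for an empty second set -/

section BaseCase

variable {K ι : Type*} [Field K] [DecidableEq ι]

theorem poch_succ' (x : K) (k : ℕ) : poch x (k + 1) = x * poch (x + 1) k := by
  rw [poch_eq_prod, prod_range_succ', poch_eq_prod, mul_comm]
  congr 1
  · simp
  · exact prod_congr rfl fun i _ => by push_cast; ring

theorem prod_prod_insert {M : Type*} [CommMonoid M] {A : Finset ι} {α : ι} (hα : α ∉ A)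
    (f : ι → ι → M) :
    ∏ β ∈ insert α A, ∏ γ ∈ insert α A, f β γ =
      f α α * (∏ β ∈ A, f α β * f β α) * ∏ β ∈ A, ∏ γ ∈ A, f β γ := by
  rw [prod_insert hα, prod_insert hα]
  simp_rw [prod_insert hα]
  rw [prod_mul_distrib, prod_mul_distrib]
  simp only [mul_assoc]

/-- Only pairs containing `α` change, and their Pochhammer symbols telescope. The value `θ = 0`
handles the denominators, which is why `sourceWeight_empty` keeps a `- 0`. -/
theorem prod_poch_add_single {J : Finset ι} {α : ι} (hα : α ∈ J) (x : ι → K) (θ : K)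
    (k : ι → ℕ) :
    (∏ β ∈ J, ∏ γ ∈ J, poch (x γ - x β - θ - ((k + Pi.single α 1 : ι → ℕ) β : K))
        ((k + Pi.single α 1 : ι → ℕ) γ)) *
        ∏ β ∈ J.erase α, (x α + k α - (x β + k β) + 1 + θ) =
      (∏ β ∈ J, ∏ γ ∈ J, poch (x γ - x β - θ - k β) (k γ)) * (-(k α + 1 + θ) *
        ∏ β ∈ J.erase α, ((x α + k α - (x β + k β) - θ) * (x α + k α - x β + 1 + θ))) := by
  obtain ⟨A, hA, rfl⟩ : ∃ A, α ∉ A ∧ J = insert α A :=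
    ⟨J.erase α, by simp, (insert_erase hα).symm⟩
  have hne : ∀ β ∈ A, (k + Pi.single α 1 : ι → ℕ) β = k β := fun β hβ => by
    simp [show β ≠ α from fun e => hA (e ▸ hβ)]
  have hself : (k + Pi.single α 1 : ι → ℕ) α = k α + 1 := by simp
  rw [prod_prod_insert hA, prod_prod_insert hA, erase_insert hA]
  have h1 : ∏ β ∈ A, ∏ γ ∈ A, poch (x γ - x β - θ - ((k + Pi.single α 1 : ι → ℕ) β : K))
        ((k + Pi.single α 1 : ι → ℕ) γ) =
      ∏ β ∈ A, ∏ γ ∈ A, poch (x γ - x β - θ - k β) (k γ) :=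
    prod_congr rfl fun β hβ => prod_congr rfl fun γ hγ => by rw [hne β hβ, hne γ hγ]
  have h2 : (∏ β ∈ A,
      poch (x β - x α - θ - ((k + Pi.single α 1 : ι → ℕ) α : K)) ((k + Pi.single α 1 : ι → ℕ) β) *
      poch (x α - x β - θ - ((k + Pi.single α 1 : ι → ℕ) β : K))
        ((k + Pi.single α 1 : ι → ℕ) α)) * ∏ β ∈ A, (x α + k α - (x β + k β) + 1 + θ) =
      (∏ β ∈ A, poch (x β - x α - θ - k α) (k β) * poch (x α - x β - θ - k β) (k α)) *
        ∏ β ∈ A, ((x α + k α - (x β + k β) - θ) * (x α + k α - x β + 1 + θ)) := by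
    rw [← prod_mul_distrib, ← prod_mul_distrib]
    refine prod_congr rfl fun β hβ => ?_
    rw [hne β hβ, hself, poch_succ]
    have e := (poch_succ (x β - x α - θ - (k α + 1)) (k β)).symm.trans
      (poch_succ' (x β - x α - θ - (k α + 1)) (k β))
    rw [show x β - x α - θ - ((k α : K) + 1) + 1 = x β - x α - θ - k α by ring] at e
    push_cast
    linear_combination -poch (x α - x β - θ - k β) (k α) * (x α - x β - θ - k β + k α) * e
  have h3 : poch (x α - x α - θ - ((k + Pi.single α 1 : ι → ℕ) α : K))
      ((k + Pi.single α 1 : ι → ℕ) α) = poch (x α - x α - θ - k α) (k α) * -(k α + 1 + θ) := by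
    rw [hself, poch_succ']
    push_cast
    rw [show x α - x α - θ - ((k α : K) + 1) + 1 = x α - x α - θ - k α by ring]
    ring
  rw [h1, h3]
  linear_combination (poch (x α - x α - θ - k α) (k α) * -(k α + 1 + θ)) *
    (∏ β ∈ A, ∏ γ ∈ A, poch (x γ - x β - θ - k β) (k γ)) * h2

omit [DecidableEq ι] in
theorem sourceWeight_empty (J : Finset ι) (x : ι → K) (θ : K) (k : ι → ℕ) :
    sourceWeight J ∅ x θ k = (∏ β ∈ J, ∏ γ ∈ J, poch (x γ - x β - θ - k β) (k γ)) /
      ∏ β ∈ J, ∏ γ ∈ J, poch (x γ - x β - 0 - k β) (k γ) := by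
  simp [sourceWeight, prod_div_distrib]

/-- The residue at `y α` of
`∏ β, (z - y β - jθ) (z - x β + 1 + θ) / ((z - y β) (z - y β + 1 + θ))`. -/
def upResidue (J : Finset ι) (x : ι → K) (θ : K) (j : ℕ) (y : ι → K) (α : ι) : K :=
  -(j * θ) * ((∏ β ∈ J.erase α, (y α - y β - j * θ) / (y α - y β)) *
    ∏ β ∈ J, (y α - x β + 1 + θ) / (y α - y β + 1 + θ))

/-- The residue at `y α - 1 - θ` of
`∏ β, (z - y β - jθ) (z - x β + 1 + θ) / ((z - y β) (z - y β + 1 + θ))`. -/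
def downResidue (J : Finset ι) (x : ι → K) (θ : K) (j : ℕ) (y : ι → K) (α : ι) : K :=
  (y α - x α) * ((∏ β ∈ J, (y α - y β - 1 - (j + 1) * θ) / (y α - y β - 1 - θ)) *
    ∏ β ∈ J.erase α, (y α - x β) / (y α - y β))

/-- The residue sum over two copies of `J`, with poles `y` and `y - 1 - θ` matched to the zeros `y +
jθ` and `x - 1 - θ`. -/
theorem sum_upResidue_add_downResidue (J : Finset ι) (x : ι → K) (θ : K) (j : ℕ) (y : ι → K)
    (h : ∀ α ∈ J, ∀ β ∈ J, α ≠ β → y α ≠ y β)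
    (h' : ∀ α ∈ J, ∀ β ∈ J, y α ≠ y β - 1 - θ) :
    ∑ α ∈ J, upResidue J x θ j y α + ∑ α ∈ J, downResidue J x θ j y α =
      ∑ α ∈ J, (y α - x α) - #J * (j * θ) := by
  have key := sum_residues (J.disjSum J) (Sum.elim (fun β => y β + j * θ) fun β => x β - 1 - θ)
    (Sum.elim y fun β => y β - 1 - θ) (by
      rintro (α | α) hα (β | β) hβ e <;>
        simp only [mem_coe, inl_mem_disjSum, inr_mem_disjSum] at hα hβ <;>
        simp only [Sum.elim_inl, Sum.elim_inr] at e
      · by_contra hne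
        exact h α hα β hβ (fun e' => hne (by rw [e'])) e
      · exact absurd e (h' α hα β hβ)
      · exact absurd e.symm (h' β hβ α hα)
      · by_contra hne
        exact h α hα β hβ (fun e' => hne (by rw [e'])) (by linear_combination e))
  have el : ∀ α, (J.disjSum J).erase (Sum.inl α) = (J.erase α).disjSum J := fun α => by
    ext (β | β) <;> simp
  have er : ∀ α, (J.disjSum J).erase (Sum.inr α) = J.disjSum (J.erase α) := fun α => by
    ext (β | β) <;> simp
  simp only [sum_disjSum, el, er, prod_disjSum, Sum.elim_inl, Sum.elim_inr] at key
  have hr : ∑ α ∈ J, (y α - (y α + j * θ)) + ∑ α ∈ J, (y α - 1 - θ - (x α - 1 - θ)) =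
      ∑ α ∈ J, (y α - x α) - #J * (j * θ) := by
    have e1 : ∀ α, y α - (y α + j * θ) = -(j * θ) := fun α => by ring
    have e2 : ∀ α, y α - 1 - θ - (x α - 1 - θ) = y α - x α := fun α => by ring
    simp only [e1, e2, sum_const, nsmul_eq_mul]
    ring
  rw [← hr, ← key]
  congr 1
  · refine sum_congr rfl fun α _ => ?_
    unfold upResidue
    congr 1
    · ring
    · congr 1
      · exact prod_congr rfl fun β _ => by congr 1; ring
      · exact prod_congr rfl fun β _ => by congr 1 <;> ring
  · refine sum_congr rfl fun α _ => ?_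
    unfold downResidue
    congr 1
    · ring
    · congr 1
      · exact prod_congr rfl fun β _ => by congr 1 <;> ring
      · exact prod_congr rfl fun β _ => by congr 1 <;> ring

/-- Raising `k α` turns `y α - y β - 1 - (j + 1)θ` into `y α - y β - (j + 1)θ` for the old `y`,
which is the factor of an up-residue at level `j + 1`. The ratio of weights absorbs the remaining
products up to a scalar free of `k`. -/
theorem sourceWeight_mul_downResidue [CharZero K] {J : Finset ι} {x : ι → K} {θ : K} {k : ι → ℕ}
    {α : ι} (hα : α ∈ J) (j : ℕ) (hθ : θ ≠ 0) (hθ' : 1 + θ ≠ 0)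
    (h1 : ∀ β ∈ J.erase α, x α + k α - (x β + k β) ≠ 0)
    (h2 : ∀ β ∈ J.erase α, x α + k α - (x β + k β) + 1 ≠ 0)
    (h3 : ∀ β ∈ J.erase α, x α + k α - x β + 1 ≠ 0)
    (h4 : ∀ β ∈ J.erase α, x α + k α - (x β + k β) - θ ≠ 0)
    (h5 : ∀ β ∈ J.erase α, x α + k α - (x β + k β) + 1 + θ ≠ 0) :
    sourceWeight J ∅ x θ (k + Pi.single α 1) *
        downResidue J x θ j (fun β => x β + ((k + Pi.single α 1 : ι → ℕ) β : K)) α =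
      -((1 + (j + 1) * θ) / ((j + 1) * θ)) *
        (sourceWeight J ∅ x θ k * upResidue J x θ (j + 1) (fun β => x β + (k β : K)) α) := by
  have hN := prod_poch_add_single hα x θ k
  have hD := prod_poch_add_single hα x 0 k
  rw [sourceWeight_empty, sourceWeight_empty]
  set N' := ∏ β ∈ J, ∏ γ ∈ J, poch (x γ - x β - θ - ((k + Pi.single α 1 : ι → ℕ) β : K))
        ((k + Pi.single α 1 : ι → ℕ) γ)
  set D' := ∏ β ∈ J, ∏ γ ∈ J, poch (x γ - x β - 0 - ((k + Pi.single α 1 : ι → ℕ) β : K))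
        ((k + Pi.single α 1 : ι → ℕ) γ)
  set N := ∏ β ∈ J, ∏ γ ∈ J, poch (x γ - x β - θ - k β) (k γ)
  set D := ∏ β ∈ J, ∏ γ ∈ J, poch (x γ - x β - 0 - k β) (k γ)
  simp only [add_zero, sub_zero, prod_mul_distrib] at hN hD
  have hdown : downResidue J x θ j (fun β => x β + ((k + Pi.single α 1 : ι → ℕ) β : K)) α =
      (k α + 1) * (((1 + (j + 1) * θ) / (1 + θ)) *
        ((∏ β ∈ J.erase α, (x α + k α - (x β + k β) - (j + 1) * θ)) /
          (∏ β ∈ J.erase α, (x α + k α - (x β + k β) - θ))) *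
        ((∏ β ∈ J.erase α, (x α + k α - x β + 1)) /
          (∏ β ∈ J.erase α, (x α + k α - (x β + k β) + 1)))) := by
    unfold downResidue
    simp only [Pi.add_apply, Pi.single_eq_same]
    congr 1
    · push_cast; ring
    · rw [← mul_prod_erase J _ hα, ← prod_div_distrib, ← prod_div_distrib]
      congr 1
      · congr 1
        · rw [← neg_div_neg_eq]
          congr 1 <;> simp <;> ring
        · refine prod_congr rfl fun β hβ => ?_
          rw [Pi.single_eq_of_ne (ne_of_mem_erase hβ)]
          push_cast
          congr 1 <;> ring
      · refine prod_congr rfl fun β hβ => ?_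
        rw [Pi.single_eq_of_ne (ne_of_mem_erase hβ)]
        push_cast
        congr 1 <;> ring
  have hup : upResidue J x θ (j + 1) (fun β => x β + (k β : K)) α =
      -((j + 1) * θ) * (((∏ β ∈ J.erase α, (x α + k α - (x β + k β) - (j + 1) * θ)) /
          (∏ β ∈ J.erase α, (x α + k α - (x β + k β)))) *
        (((k α + 1 + θ) / (1 + θ)) * ((∏ β ∈ J.erase α, (x α + k α - x β + 1 + θ)) /
          (∏ β ∈ J.erase α, (x α + k α - (x β + k β) + 1 + θ))))) := by
    unfold upResidue
    rw [← mul_prod_erase J _ hα, ← prod_div_distrib, ← prod_div_distrib]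
    congr 1
    · push_cast; ring
    · congr 1
      · exact prod_congr rfl fun β _ => by push_cast; ring
      · congr 1
        congr 1 <;> ring
  rw [hdown, hup]
  have e1 := prod_ne_zero_iff.2 h1
  have e2 := prod_ne_zero_iff.2 h2
  have e3 := prod_ne_zero_iff.2 h3
  have e4 := prod_ne_zero_iff.2 h4
  have e5 := prod_ne_zero_iff.2 h5
  have e6 : (k α + 1 : K) ≠ 0 := by exact_mod_cast (k α).succ_ne_zero
  have e7 : (j + 1 : K) ≠ 0 := by exact_mod_cast j.succ_ne_zero
  rw [← eq_div_iff e5] at hN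
  rw [← eq_div_iff e2] at hD
  rw [hN, hD]
  generalize ∏ β ∈ J.erase α, (x α + k α - (x β + k β)) = b1 at *
  generalize ∏ β ∈ J.erase α, (x α + k α - (x β + k β) + 1) = b3 at *
  generalize ∏ β ∈ J.erase α, (x α + k α - x β + 1) = b2 at *
  generalize ∏ β ∈ J.erase α, (x α + k α - (x β + k β) - θ) = a1 at *
  generalize ∏ β ∈ J.erase α, (x α + k α - (x β + k β) + 1 + θ) = a3 at *
  generalize ∏ β ∈ J.erase α, (x α + k α - x β + 1 + θ) = a2 at *
  generalize ∏ β ∈ J.erase α, (x α + k α - (x β + k β) - (j + 1) * θ) = c at *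
  -- If the old denominator vanishes, both sides are zero by the convention for division, so its
  -- nonvanishing need not be assumed.
  by_cases hD0 : D = 0
  · simp [hD0]
  field_simp

/-- Genericity of `θ` keeps the poles `y` and `y - 1 - θ` apart; the bound `N + 1` accounts for the
extra unit shift. -/
theorem succ_mul_sum_sourceWeight_empty_of_generic [CharZero K] {J : Finset ι} {x : ι → K}
    {θ : K} {N : ℕ}
    (hx : NonResonant J ∅ x N) (hθ : θ ≠ 0) (hθ' : 1 + θ ≠ 0)
    (h : ∀ α ∈ J, ∀ β ∈ J, ∀ m : ℤ, |m| ≤ N + 1 → x α - x β + m ≠ θ) (n : ℕ) (hn : n < N) :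
    (n + 1 : K) * ∑ k ∈ J.piAntidiag (n + 1), sourceWeight J ∅ x θ k =
      (#J * (1 + θ)) * ∑ i ∈ range (n + 1), ∑ k ∈ J.piAntidiag i, sourceWeight J ∅ x θ k := by
  let c : ℕ → K := fun n => ∑ k ∈ J.piAntidiag n, sourceWeight J ∅ x θ k
  let U : ℕ → ℕ → K := fun j n => ∑ k ∈ J.piAntidiag n, sourceWeight J ∅ x θ k *
    ∑ α ∈ J, upResidue J x θ j (fun β => x β + (k β : K)) α
  let D : ℕ → ℕ → K := fun j n => ∑ k ∈ J.piAntidiag n, sourceWeight J ∅ x θ k *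
    ∑ α ∈ J, downResidue J x θ j (fun β => x β + (k β : K)) α
  have hres : ∀ j n, n ≤ N → U j n + D j n = (n - #J * (j * θ)) * c n := by
    intro j n hn
    simp only [U, D, c]
    rw [← sum_add_distrib, mul_sum]
    refine sum_congr rfl fun k hk => ?_
    rw [← mul_add, sum_upResidue_add_downResidue]
    · have : ∑ α ∈ J, (x α + (k α : K) - x α) = n := by
        simp only [add_sub_cancel_left]
        rw [← (mem_piAntidiag.1 hk).1, Nat.cast_sum]
      rw [this, mul_comm]
    · intro α hα β hβ hne e
      have := le_of_mem_piAntidiag hk hα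
      have := le_of_mem_piAntidiag hk hβ
      refine hx.left α hα β hβ hne (k β - k α) (by rw [abs_le]; omega) ?_
      push_cast
      linear_combination e
    · intro α hα β hβ e
      have := le_of_mem_piAntidiag hk hα
      have := le_of_mem_piAntidiag hk hβ
      refine h β hβ α hα (k β - k α - 1) (by rw [abs_le]; omega) ?_
      push_cast
      linear_combination -e
  have hD0 : ∀ j, D j 0 = 0 := by
    intro j
    simp only [D, piAntidiag_zero, sum_singleton]
    rw [sum_eq_zero (fun α _ => by simp [downResidue]), mul_zero]
  have hDs : ∀ j n, n < N → D j (n + 1) = -((1 + (j + 1) * θ) / ((j + 1) * θ)) * U (j + 1) n := by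
    intro j n hn
    have e1 : D j (n + 1) = ∑ k ∈ J.piAntidiag (n + 1), ∑ α ∈ J with k α ≠ 0,
        sourceWeight J ∅ x θ k * downResidue J x θ j (fun β => x β + (k β : K)) α := by
      refine sum_congr rfl fun k _ => ?_
      rw [mul_sum, sum_filter]
      refine sum_congr rfl fun α _ => ?_
      by_cases h0 : k α = 0 <;> simp [h0, downResidue]
    rw [e1, sum_piAntidiag_succ J n fun α k =>
      sourceWeight J ∅ x θ k * downResidue J x θ j (fun β => x β + (k β : K)) α]
    simp only [U, mul_sum]
    refine sum_congr rfl fun k hk => sum_congr rfl fun α hα => ?_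
    have ka := le_of_mem_piAntidiag hk hα
    have hint : ∀ β ∈ J.erase α, ∀ m : ℤ, |m| ≤ N → x α - x β + m ≠ 0 := fun β hβ m hm e =>
      hx.left α hα β (mem_of_mem_erase hβ) (ne_of_mem_erase hβ).symm (-m) (by rwa [abs_neg])
        (by push_cast; linear_combination e)
    refine sourceWeight_mul_downResidue hα j hθ hθ' ?_ ?_ ?_ ?_ ?_ <;> intro β hβ e <;>
      have kb := le_of_mem_piAntidiag hk (mem_of_mem_erase hβ)
    · refine hint β hβ (k α - k β) (by rw [abs_le]; omega) ?_
      push_cast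
      linear_combination e
    · refine hint β hβ (k α - k β + 1) (by rw [abs_le]; omega) ?_
      push_cast
      linear_combination e
    · refine hint β hβ (k α + 1) (by rw [abs_le]; omega) ?_
      push_cast
      linear_combination e
    · refine h α hα β (mem_of_mem_erase hβ) (k α - k β) (by rw [abs_le]; omega) ?_
      push_cast
      linear_combination e
    · refine h β (mem_of_mem_erase hβ) α hα (k β - k α - 1) (by rw [abs_le]; omega) ?_
      push_cast
      linear_combination -e
  have hU0 : ∀ n, U 0 n = 0 := fun n => sum_eq_zero fun k _ => by
    rw [sum_eq_zero (fun α _ => by simp [upResidue]), mul_zero]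
  have hDU : ∀ n, n < N → (∀ j : ℕ, U j n = -(j * θ) * (#J * ∑ i ∈ range (n + 1), c i)) →
      ∀ j : ℕ, D j (n + 1) = (1 + (j + 1) * θ) * (#J * ∑ i ∈ range (n + 1), c i) := by
    intro n hn ih j
    have j0 : (j + 1 : K) ≠ 0 := by exact_mod_cast j.succ_ne_zero
    rw [hDs j n hn, ih]
    push_cast
    field_simp
  -- Induction on `n` for all `j` at once: `D j (n + 1)` requires `U (j + 1) n`. Since `U 0`
  -- vanishes, the residue sum at `j = 0` yields `c (n + 1)`, and subtracting it from the sum at `j`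
  -- yields `U j (n + 1)`.
  have hU : ∀ n, n ≤ N → ∀ j : ℕ, U j n = -(j * θ) * (#J * ∑ i ∈ range (n + 1), c i) := by
    intro n
    induction n with
    | zero =>
      intro _ j
      have := hres j 0 (Nat.zero_le _)
      rw [hD0] at this
      simp only [zero_add, sum_range_one]
      push_cast at this
      linear_combination this
    | succ n ih =>
      intro hn j
      have e0 := hres 0 (n + 1) hn
      have ej := hres j (n + 1) hn
      rw [hDU n hn (ih (by omega))] at e0 ej
      rw [hU0] at e0
      rw [sum_range_succ]
      push_cast at e0 ej
      linear_combination ej - e0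
  have e0 := hres 0 (n + 1) hn
  rw [hDU n hn (hU n hn.le), hU0] at e0
  change (n + 1 : K) * c (n + 1) = _ * ∑ i ∈ range (n + 1), c i
  push_cast at e0
  linear_combination -e0

theorem sum_sourceWeight_empty [CharZero K] {J : Finset ι} {x : ι → K} {N : ℕ}
    (hx : NonResonant J ∅ x N) (θ : K) :
    ∑ k ∈ J.piAntidiag N, sourceWeight J ∅ x θ k =
      PowerSeries.coeff N (oneSubPow (-(#J : K) * (θ + 1))) := by
  refine eq_coeff_oneSubPow _ (fun n => ∑ k ∈ J.piAntidiag n, sourceWeight J ∅ x θ k) N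
    (by simp [sourceWeight_zero]) (fun n hn => ?_) N le_rfl
  -- The finitely many values of `θ` excluded by the generic case; the recurrence extends over them
  -- as an identity of rational functions of `θ`.
  let s : Set K := {0, -1} ∪ ⋃ α ∈ J, ⋃ β ∈ J, ⋃ m ∈ Finset.Icc (-(N + 1 : ℤ)) (N + 1),
    {x α - x β + m}
  have hs : s.Finite := by
    refine Set.Finite.union (Set.toFinite _) ?_
    exact J.finite_toSet.biUnion fun α _ => J.finite_toSet.biUnion fun β _ =>
      (Finset.finite_toSet _).biUnion fun m _ => Set.finite_singleton _
  have hreg : ∀ n ≤ N, RegularAt θ fun t => ∑ k ∈ J.piAntidiag n, sourceWeight J ∅ x t k :=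
    fun n hn => RegularAt.sum _ fun k hk => RegularAt.sourceWeight (x := fun α _ => x α) hx
      (fun α hα => (le_of_mem_piAntidiag hk hα).trans hn) (fun α => RegularAt.const _ _) (RegularAt.id _)
  have key := RegularAt.eq_of_finite (z := θ)
    ((RegularAt.const θ (n + 1 : K)).mul (hreg (n + 1) hn))
    (((RegularAt.const θ (#J : K)).mul ((RegularAt.const θ 1).add (RegularAt.id θ))).mul
      (RegularAt.sum (range (n + 1)) fun i hi => hreg i (by have := mem_range.1 hi; omega))) hs
    (fun t ht => by
      simp only [s, Set.mem_union, Set.mem_insert_iff, Set.mem_singleton_iff, Set.mem_iUnion,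
        not_or, not_exists, Finset.mem_Icc] at ht
      refine succ_mul_sum_sourceWeight_empty_of_generic hx ht.1.1
        (fun e => ht.1.2 (by linear_combination e)) (fun α hα β hβ m hm e => ?_) n hn
      exact ht.2 α hα β hβ m (abs_le.1 hm) e.symm)
  rw [key]
  ring

end BaseCase

/-! ### Poles and residues under a translation of the coordinates in the second set -/

section MixedPoles

variable {K ι : Type*} [Field K]

theorem poch_add (x : K) (m n : ℕ) : poch x (m + n) = poch x m * poch (x + m) n := by
  simp only [poch_eq_prod, prod_range_add]
  congr 1
  exact prod_congr rfl fun i _ => by push_cast; ring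

theorem poch_sub_natCast (z : K) (k : ℕ) : poch (z - k) k = ∏ i ∈ range k, (z - 1 - i) := by
  rw [poch_eq_prod, ← prod_range_reflect]
  refine prod_congr rfl fun i hi => ?_
  have h : k - 1 - i + i + 1 = k := by have := mem_range.1 hi; omega
  have h' : ((k - 1 - i : ℕ) : K) + i + 1 = k := by
    rw [← Nat.cast_add, ← Nat.cast_add_one, h]
  linear_combination h'

/-- The quotient `(x - θ)_k / (x)_k`. -/
noncomputable def pochRatio (θ x : K) (k : ℕ) : K := poch (x - θ) k / poch x k

theorem pochRatio_add (θ x : K) (m n : ℕ) :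
    pochRatio θ x (m + n) = pochRatio θ x m * pochRatio θ (x + m) n := by
  unfold pochRatio
  rw [poch_add, poch_add, mul_div_mul_comm, show x - θ + m = x + m - θ by ring]

theorem pochRatio_sub_natCast (θ z : K) (k : ℕ) :
    pochRatio θ (z - k) k = ∏ i ∈ range k, ((z - 1 - i - θ) / (z - 1 - i)) := by
  unfold pochRatio
  rw [show z - k - θ = z - θ - k by ring, poch_sub_natCast, poch_sub_natCast, ← prod_div_distrib]
  exact prod_congr rfl fun i _ => by congr 1; ring

theorem sourceWeight_eq_pochRatio (I J : Finset ι) (x : ι → K) (θ : K) (k : ι → ℕ) :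
    sourceWeight I J x θ k =
      (∏ β ∈ I, ∏ α ∈ I, pochRatio θ (x α - x β - k β) (k α)) *
        ∏ β ∈ I, ∏ α ∈ J, pochRatio θ (x α - x β - k β) (k β) := by
  simp only [sourceWeight, pochRatio, sub_right_comm _ _ θ]

theorem sourceWeight_add_const (I J : Finset ι) (x : ι → K) (c θ : K) (k : ι → ℕ) :
    sourceWeight I J (fun γ => x γ + c) θ k = sourceWeight I J x θ k := by
  simp [sourceWeight]

variable [DecidableEq ι]

/-- The translate of `x` by `t` in the coordinates in `J`. -/
def shiftOn (J : Finset ι) (x : ι → K) (t : K) : ι → K := fun γ => if γ ∈ J then x γ + t else x γ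

/-- The poles in `t` of the summands of the source identity for `shiftOn J x t`. -/
def pole (x : ι → K) (p : ι × ι × ℕ) : K := x p.1 - x p.2.1 + 1 + p.2.2

/-- The indices of the poles of the summand of index `k`. -/
def mixedPoles (I J : Finset ι) (N : ℕ) (k : ι → ℕ) : Finset (ι × ι × ℕ) :=
  {p ∈ I ×ˢ J ×ˢ range N | p.2.2 < k p.1}

omit [DecidableEq ι] in
theorem prod_mixedPoles {I J : Finset ι} {N : ℕ} {k : ι → ℕ} (hk : ∀ a ∈ I, k a ≤ N)
    (F : ι × ι × ℕ → K) :
    ∏ p ∈ mixedPoles I J N k, F p = ∏ a ∈ I, ∏ c ∈ J, ∏ i ∈ range (k a), F (a, c, i) := by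
  unfold mixedPoles
  rw [prod_filter, prod_product]
  refine prod_congr rfl fun a ha => ?_
  rw [prod_product]
  refine prod_congr rfl fun c _ => ?_
  rw [← prod_filter]
  refine prod_congr ?_ fun _ _ => rfl
  ext i
  have := hk a ha
  simp only [mem_filter, mem_range]
  omega

theorem sourceWeight_shiftOn {I J : Finset ι} (hd : Disjoint I J) (x : ι → K) (θ t : K)
    {N : ℕ} {k : ι → ℕ} (hk : ∀ a ∈ I, k a ≤ N) :
    sourceWeight I J (shiftOn J x t) θ k = sourceWeight I ∅ x θ k *
      ∏ p ∈ mixedPoles I J N k, ((t - (pole x p + θ)) / (t - pole x p)) := by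
  have hI : ∀ a ∈ I, shiftOn J x t a = x a := fun a ha => by
    simp [shiftOn, disjoint_left.1 hd ha]
  rw [sourceWeight_eq_pochRatio, sourceWeight_eq_pochRatio, prod_mixedPoles hk]
  simp only [prod_empty, prod_const_one, mul_one]
  congr 1
  · exact prod_congr rfl fun β hβ => prod_congr rfl fun α hα => by rw [hI α hα, hI β hβ]
  · refine prod_congr rfl fun β hβ => prod_congr rfl fun α hα => ?_
    rw [hI β hβ, pochRatio_sub_natCast]
    refine prod_congr rfl fun i _ => ?_
    simp only [shiftOn, hα, if_true, pole]
    congr 1 <;> ring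

/-- The residue at `t = pole x p` of the summand of index `k` for `shiftOn J x t`. -/
noncomputable def mixedResidue (I J : Finset ι) (x : ι → K) (θ : K) (N : ℕ) (p : ι × ι × ℕ) (k : ι → ℕ) : K :=
  sourceWeight I ∅ x θ k * ((pole x p - (pole x p + θ)) *
    ∏ q ∈ (mixedPoles I J N k).erase p, ((pole x p - (pole x q + θ)) / (pole x p - pole x q)))

/-- Each summand is its value at `t = ∞` times factors tending to `1`, so partial fractions apply
termwise. Only multi-indices with `k α > s` have a pole at `(α, β, s)`. -/
theorem sum_sourceWeight_shiftOn {I J : Finset ι} (hd : Disjoint I J) (x : ι → K) (θ t : K)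
    {N n : ℕ} (hn : n ≤ N) (hinj : Set.InjOn (pole x) (I ×ˢ J ×ˢ range N : Finset (ι × ι × ℕ)))
    (ht : ∀ p ∈ I ×ˢ J ×ˢ range N, t ≠ pole x p) :
    ∑ k ∈ I.piAntidiag n, sourceWeight I J (shiftOn J x t) θ k =
      ∑ k ∈ I.piAntidiag n, sourceWeight I ∅ x θ k +
        ∑ α ∈ I, ∑ β ∈ J, ∑ s ∈ range N, (t - pole x (α, β, s))⁻¹ *
          ∑ k ∈ I.piAntidiag n with s < k α, mixedResidue I J x θ N (α, β, s) k := by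
  have h1 : ∀ k ∈ I.piAntidiag n, sourceWeight I J (shiftOn J x t) θ k =
      sourceWeight I ∅ x θ k + ∑ p ∈ I ×ˢ J ×ˢ range N,
        (t - pole x p)⁻¹ * if p.2.2 < k p.1 then mixedResidue I J x θ N p k else 0 := by
    intro k hk
    have hsub : mixedPoles I J N k ⊆ I ×ˢ J ×ˢ range N := filter_subset _ _
    rw [sourceWeight_shiftOn hd x θ t fun a ha => (le_of_mem_piAntidiag hk ha).trans hn,
      prod_div_eq_one_add_sum _ _ _ (hinj.mono (coe_subset.2 hsub)) t
        fun p hp => ht p (hsub hp), mul_add, mul_one, mul_sum]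
    congr 1
    conv_lhs => rw [mixedPoles]
    rw [sum_filter]
    refine sum_congr rfl fun p _ => ?_
    split_ifs
    · rw [mixedResidue, ← mixedPoles]; ring
    · rw [mul_zero]
  rw [sum_congr rfl h1, sum_add_distrib, sum_comm]
  congr 1
  simp only [sum_product, mul_sum, sum_filter, mul_ite, mul_zero]

/-- The factor by which the residue of the source identity at `pole x (α, β, s)` differs from the
source identity of lower order, where `σ = s + 1`, `A = I \ {α}` and `B = J \ {β}`. -/
noncomputable def residueFactor (A B : Finset ι) (x : ι → K) (θ : K) (α β : ι) (s : ℕ) : K :=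
  -θ * pochRatio θ (-(s + 1 : ℕ)) (s + 1) * (∏ i ∈ range s, (((s : K) - i - θ) / (s - i))) *
    ((∏ a ∈ A, pochRatio θ (x α - x a) (s + 1)) * ∏ c ∈ B, pochRatio θ (x c - x β) (s + 1))

-- The symmetry that makes the residue factors on the two sides of the identity agree.
omit [DecidableEq ι] in
theorem residueFactor_neg (A B : Finset ι) (x : ι → K) (θ : K) (α β : ι) (s : ℕ) :
    residueFactor B A (-x) θ β α s = residueFactor A B x θ α β s := by
  unfold residueFactor
  congr 1
  rw [mul_comm]
  congr 1 <;> exact prod_congr rfl fun _ _ => by congr 1; simp only [Pi.neg_apply]; ring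

/-- At the pole the translated `x β` equals `x α + s + 1`. Assigning this value to `α` and `x α` to
`β` absorbs the shift of `k α` by `s + 1`; what remains after splitting the Pochhammer ratios does
not involve `k`. -/
theorem mixedResidue_add_single {A B : Finset ι} {α β : ι} (hα : α ∉ A) (hβ : β ∉ B)
    (hd : Disjoint (insert α A) (insert β B)) (x : ι → K) (θ : K) {N s : ℕ} (hs : s < N)
    {k : ι → ℕ} (hk : ∀ a ∈ insert α A, (k + Pi.single α (s + 1) : ι → ℕ) a ≤ N) :
    mixedResidue (insert α A) (insert β B) x θ N (α, β, s) (k + Pi.single α (s + 1)) =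
      residueFactor A B x θ α β s * sourceWeight (insert α A) (insert β B)
        (shiftOn (insert β B) x (pole x (α, β, s)) ∘ Equiv.swap α β) θ k := by
  have hαB : α ∉ insert β B := disjoint_left.1 hd (mem_insert_self _ _)
  have hβA : β ∉ insert α A := disjoint_right.1 hd (mem_insert_self _ _)
  have hAB : ∀ a ∈ A, a ∉ insert β B := fun a ha =>
    disjoint_left.1 hd (mem_insert_of_mem ha)
  have hBA : ∀ c ∈ B, c ∉ insert α A := fun c hc =>
    disjoint_right.1 hd (mem_insert_of_mem hc)
  set x' := shiftOn (insert β B) x (pole x (α, β, s)) ∘ Equiv.swap α β with hx'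
  have xα : x' α = x α + (s + 1) := by
    simp [hx', shiftOn, pole]; ring
  have xβ : x' β = x α := by
    rw [hx', Function.comp_apply, Equiv.swap_apply_right, shiftOn, if_neg hαB]
  have xA : ∀ a ∈ A, x' a = x a := fun a ha => by
    have h1 : a ≠ α := fun e => hα (e ▸ ha)
    have h2 : a ≠ β := fun e => hβA (e ▸ mem_insert_of_mem ha)
    rw [hx', Function.comp_apply, Equiv.swap_apply_of_ne_of_ne h1 h2, shiftOn, if_neg (hAB a ha)]
  have xB : ∀ c ∈ B, x' c = x c - x β + (x α + (s + 1)) := fun c hc => by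
    have h1 : c ≠ α := fun e => hBA c hc (e ▸ mem_insert_self _ _)
    have h2 : c ≠ β := fun e => hβ (e ▸ hc)
    rw [hx', Function.comp_apply, Equiv.swap_apply_of_ne_of_ne h1 h2, shiftOn,
      if_pos (mem_insert_of_mem hc)]
    simp only [pole]
    ring
  set k' := k + Pi.single α (s + 1) with hk'
  have kα : k' α = k α + (s + 1) := by simp [hk']
  have kA : ∀ a ∈ A, k' a = k a := fun a ha => by
    simp [hk', show a ≠ α from fun e => hα (e ▸ ha)]
  -- Setting the omitted factor to `1` makes the product run over a full box and so factor over
  -- pairs.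
  let F : ι × ι × ℕ → K := fun q => if q = (α, β, s) then 1 else
    (pole x (α, β, s) - (pole x q + θ)) / (pole x (α, β, s) - pole x q)
  have hF : ∏ q ∈ (mixedPoles (insert α A) (insert β B) N k').erase (α, β, s),
      ((pole x (α, β, s) - (pole x q + θ)) / (pole x (α, β, s) - pole x q)) =
      ∏ q ∈ mixedPoles (insert α A) (insert β B) N k', F q := by
    have hmem : (α, β, s) ∈ mixedPoles (insert α A) (insert β B) N k' := by
      simp [mixedPoles, hs, kα]
      omega
    rw [← mul_prod_erase _ _ hmem]
    simp only [F, if_true, one_mul]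
    exact prod_congr rfl fun q hq => by rw [if_neg (ne_of_mem_erase hq)]
  have hg : ∀ a ∈ insert α A, ∀ c ∈ insert β B, ¬(a = α ∧ c = β) →
      ∏ i ∈ range (k' a), F (a, c, i) =
        pochRatio θ (x c - x β + (x α + (s + 1)) - x a - k' a) (k' a) := by
    intro a _ c _ hne
    rw [pochRatio_sub_natCast]
    refine prod_congr rfl fun i _ => ?_
    simp only [F]
    rw [if_neg (fun e => by simp only [Prod.mk.injEq] at e; exact hne ⟨e.1, e.2.1⟩)]
    simp only [pole]
    congr 1 <;> ring
  have hgαβ : ∏ i ∈ range (k' α), F (α, β, i) =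
      (∏ i ∈ range s, (((s : K) - i - θ) / (s - i))) * pochRatio θ (0 - k α) (k α) := by
    rw [pochRatio_sub_natCast, kα, show k α + (s + 1) = s + 1 + k α by ring, prod_range_add,
      prod_range_succ]
    congr 1
    · rw [show F (α, β, s) = 1 by simp [F], mul_one]
      refine prod_congr rfl fun i hi => ?_
      simp only [F]
      rw [if_neg (fun e => by simp at e; have := mem_range.1 hi; omega)]
      simp only [pole]
      congr 1 <;> ring
    · refine prod_congr rfl fun i hi => ?_
      simp only [F]
      rw [if_neg (fun e => by simp at e; omega)]
      simp only [pole]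
      push_cast
      congr 1 <;> ring
  have hsplit : ∏ a ∈ insert α A, ∏ c ∈ insert β B, ∏ i ∈ range (k' a), F (a, c, i) =
      ((∏ i ∈ range s, (((s : K) - i - θ) / (s - i))) * pochRatio θ (0 - k α) (k α)) *
      (∏ c ∈ B, pochRatio θ (x c - x β - k α) (k α + (s + 1))) *
      ((∏ a ∈ A, pochRatio θ (x α - x a - k a + (s + 1 : ℕ)) (k a)) *
        ∏ a ∈ A, ∏ c ∈ B, pochRatio θ (x' c - x' a - k a) (k a)) := by
    rw [prod_insert hα, prod_insert hβ, hgαβ, ← prod_mul_distrib]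
    congr 1
    · congr 1
      refine prod_congr rfl fun c hc => ?_
      rw [hg α (mem_insert_self _ _) c (mem_insert_of_mem hc)
        (fun e => hβ (e.2 ▸ hc)), kα]
      congr 1
      push_cast
      ring
    · refine prod_congr rfl fun a ha => ?_
      have ne : a ≠ α := fun e => hα (e ▸ ha)
      rw [prod_insert hβ]
      congr 1
      · rw [hg a (mem_insert_of_mem ha) β (mem_insert_self _ _) (fun e => ne e.1), kA a ha]
        congr 1
        push_cast
        ring
      · refine prod_congr rfl fun c hc => ?_
        rw [hg a (mem_insert_of_mem ha) c (mem_insert_of_mem hc) (fun e => ne e.1), kA a ha,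
          xB c hc, xA a ha]
  unfold mixedResidue
  rw [hF, prod_mixedPoles hk, hsplit, sourceWeight_eq_pochRatio, sourceWeight_eq_pochRatio,
    prod_prod_insert hα, prod_prod_insert hα]
  have p1 : ∏ b ∈ A, ∏ c ∈ A, pochRatio θ (x c - x b - k' b) (k' c) =
      ∏ b ∈ A, ∏ c ∈ A, pochRatio θ (x' c - x' b - k b) (k c) :=
    prod_congr rfl fun b hb => prod_congr rfl fun c hc => by
      rw [xA b hb, xA c hc, kA b hb, kA c hc]
  have p2 : pochRatio θ (x α - x α - k' α) (k' α) =
      pochRatio θ (-(s + 1 : ℕ) - k α) (k α) * pochRatio θ (-(s + 1 : ℕ)) (s + 1) := by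
    rw [kα, pochRatio_add, show x α - x α - ((k α + (s + 1) : ℕ) : K) = -(s + 1 : ℕ) - k α by
      push_cast; ring, show (-((s + 1 : ℕ) : K) - k α + k α) = -(s + 1 : ℕ) by ring]
  -- The exchange splits a ratio of length `k b + (s + 1)` in both orders, which frees a factor
  -- independent of `k`.
  have p3 : (∏ b ∈ A, pochRatio θ (x b - x α - k' α) (k' b) *
      pochRatio θ (x α - x b - k' b) (k' α)) *
        ∏ a ∈ A, pochRatio θ (x α - x a - k a + (s + 1 : ℕ)) (k a) =
      (∏ a ∈ A, pochRatio θ (x α - x a) (s + 1)) *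
      ((∏ b ∈ A, pochRatio θ (x' b - x' α - k α) (k b) *
        pochRatio θ (x' α - x' b - k b) (k α)) *
        ∏ b ∈ A, pochRatio θ (x' β - x' b - k b) (k b)) := by
    rw [← prod_mul_distrib, ← prod_mul_distrib, ← prod_mul_distrib]
    refine prod_congr rfl fun b hb => ?_
    rw [kA b hb, kα, xα, xβ, xA b hb]
    have e1 := pochRatio_add θ (x α - x b - k b) (s + 1) (k b)
    have e2 := pochRatio_add θ (x α - x b - k b) (k b) (s + 1)
    have e3 := pochRatio_add θ (x α - x b - k b) (s + 1) (k α)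
    rw [show x α - x b - (k b : K) + k b = x α - x b by ring, add_comm (k b), e1] at e2
    rw [show k α + (s + 1) = s + 1 + k α by ring, e3,
      show x b - (x α + ((s : K) + 1)) - k α = x b - x α - ((s + 1 + k α : ℕ) : K) by
        push_cast; ring,
      show x α + ((s : K) + 1) - x b - k b = x α - x b - k b + (s + 1 : ℕ) by push_cast; ring]
    linear_combination pochRatio θ (x b - x α - ((s + 1 + k α : ℕ) : K)) (k b) *
      pochRatio θ (x α - x b - k b + (s + 1 : ℕ)) (k α) * e2
  have p4 : ∏ c ∈ B, pochRatio θ (x c - x β - k α) (k α + (s + 1)) =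
      (∏ c ∈ B, pochRatio θ (x c - x β) (s + 1)) *
        ∏ c ∈ B, pochRatio θ (x' c - x' α - k α) (k α) := by
    rw [← prod_mul_distrib]
    refine prod_congr rfl fun c hc => ?_
    rw [pochRatio_add, xB c hc, xα, mul_comm]
    congr 2 <;> ring
  have p5 : ∏ b ∈ insert α A, ∏ c ∈ insert β B, pochRatio θ (x' c - x' b - k b) (k b) =
      (pochRatio θ (-(s + 1 : ℕ) - k α) (k α) *
        ∏ c ∈ B, pochRatio θ (x' c - x' α - k α) (k α)) *
      ((∏ b ∈ A, pochRatio θ (x' β - x' b - k b) (k b)) *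
        ∏ b ∈ A, ∏ c ∈ B, pochRatio θ (x' c - x' b - k b) (k b)) := by
    rw [prod_insert hα, prod_insert hβ, ← prod_mul_distrib]
    congr 1
    · congr 2
      rw [xα, xβ]; push_cast; ring
    · exact prod_congr rfl fun b _ => prod_insert hβ
  rw [p1, p2, p4, p5]
  simp only [prod_empty, prod_const_one, mul_one]
  rw [show x' α - x' α - (k α : K) = 0 - k α by ring]
  unfold residueFactor
  linear_combination (pochRatio θ (-(s + 1 : ℕ) - k α) (k α) *
    pochRatio θ (-(s + 1 : ℕ)) (s + 1)) *
    (∏ b ∈ A, ∏ c ∈ A, pochRatio θ (x' c - x' b - k b) (k c)) *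
    (-θ * (((∏ i ∈ range s, (((s : K) - i - θ) / (s - i))) * pochRatio θ (0 - k α) (k α)) *
      ((∏ c ∈ B, pochRatio θ (x c - x β) (s + 1)) *
        ∏ c ∈ B, pochRatio θ (x' c - x' α - k α) (k α)) *
      ∏ b ∈ A, ∏ c ∈ B, pochRatio θ (x' c - x' b - k b) (k b))) * p3

end MixedPoles

/-! ### Convolution with a shifted sequence -/

section Convolution

variable {K : Type*} [Field K]

theorem sum_antidiagonal_mul_ite (e h : ℕ → K) {N s : ℕ} (hs : s < N) :
    ∑ p ∈ antidiagonal N, e p.1 * (if s < p.2 then h (p.2 - (s + 1)) else 0) =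
      ∑ p ∈ antidiagonal (N - (s + 1)), e p.1 * h p.2 := by
  have h1 : PowerSeries.coeff N (PowerSeries.mk e * (PowerSeries.X ^ (s + 1) * PowerSeries.mk h)) =
      PowerSeries.coeff (N - (s + 1)) (PowerSeries.mk e * PowerSeries.mk h) := by
    rw [mul_left_comm, PowerSeries.coeff_X_pow_mul', if_pos (Nat.succ_le_of_lt hs)]
  rw [PowerSeries.coeff_mul, PowerSeries.coeff_mul] at h1
  simpa only [PowerSeries.coeff_X_pow_mul', PowerSeries.coeff_mk, Nat.succ_le_iff] using h1

end Convolution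

/-! ### Induction step of (b) at generic points -/

section SourceIdentity

variable {K ι : Type*} [Field K] [CharZero K] [DecidableEq ι]

/-- The differences `x α - x β`, with `α ∈ I` and `β ∈ J`, do not differ from each other by
integers of absolute value at most `n`. -/
def Separated (I J : Finset ι) (x : ι → K) (n : ℕ) : Prop :=
  ∀ α ∈ I, ∀ β ∈ J, ∀ α' ∈ I, ∀ β' ∈ J, (α, β) ≠ (α', β') → ∀ m : ℤ, |m| ≤ n →
    x α - x β - (x α' - x β') ≠ m

omit [CharZero K] [DecidableEq ι] in
theorem Separated.neg {I J : Finset ι} {x : ι → K} {n : ℕ} (h : Separated I J x n) :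
    Separated J I (-x) n := by
  intro β hβ α hα β' hβ' α' hα' hne m hm e
  refine h α hα β hβ α' hα' β' hβ' (fun e' => hne ?_) m hm ?_
  · rw [Prod.mk.injEq] at e' ⊢
    exact e'.symm
  · simp only [Pi.neg_apply] at e
    linear_combination e

omit [DecidableEq ι] in
theorem Separated.injOn_pole {I J : Finset ι} {x : ι → K} {n : ℕ} (h : Separated I J x n) :
    Set.InjOn (pole x) (I ×ˢ J ×ˢ range n : Finset (ι × ι × ℕ)) := by
  rintro ⟨α, β, i⟩ hp ⟨α', β', i'⟩ hp' e
  simp only [mem_coe, mem_product, mem_range] at hp hp'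
  simp only [pole] at e
  by_cases hne : (α, β) = (α', β')
  · rw [Prod.mk.injEq] at hne
    obtain ⟨rfl, rfl⟩ := hne
    have : (i : K) = i' := by linear_combination e
    rw [Nat.cast_injective this]
  · refine absurd ?_ (h α hp.1 β hp.2.1 α' hp'.1 β' hp'.2.1 hne (i' - i) ?_)
    · push_cast
      linear_combination e
    · rw [abs_le]
      omega

omit [CharZero K] in
omit [DecidableEq ι] in
theorem NonResonant.zero_ne_pole {I J : Finset ι} {x : ι → K} {n : ℕ} (h : NonResonant I J x n) :
    ∀ p ∈ I ×ˢ J ×ˢ range n, (0 : K) ≠ pole x p := by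
  rintro ⟨α, β, i⟩ hp e
  simp only [mem_product, mem_range] at hp
  simp only [pole] at e
  exact h.mixed β hp.2.1 α hp.1 i hp.2.2 (by linear_combination e)

/-- The drop in order by `s + 1` pays for differences shifted by `s + 1`. Separation is needed only
for mixed pairs avoiding both `α` and `β`; the pair `(β, α)` itself gives the difference `-(s + 1)`,
which is harmless. -/
theorem NonResonant.swap {I J : Finset ι} (hd : Disjoint I J) {x : ι → K} {N s : ℕ}
    (h : NonResonant I J x N)
    (hsep : Separated I J x N) (hs : s < N) {α β : ι} (hα : α ∈ I) (hβ : β ∈ J) :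
    NonResonant I J (shiftOn J x (pole x (α, β, s)) ∘ Equiv.swap α β) (N - (s + 1)) := by
  have hαJ : α ∉ J := disjoint_left.1 hd hα
  have hβI : β ∉ I := disjoint_right.1 hd hβ
  set x' := shiftOn J x (pole x (α, β, s)) ∘ Equiv.swap α β with hx'
  have xα : x' α = x α + (s + 1) := by
    simp [hx', shiftOn, pole, hβ]; ring
  have xβ : x' β = x α := by
    rw [hx', Function.comp_apply, Equiv.swap_apply_right, shiftOn, if_neg hαJ]
  have xI : ∀ a ∈ I, a ≠ α → x' a = x a := fun a ha h1 => by
    have h2 : a ≠ β := fun e => hβI (e ▸ ha)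
    rw [hx', Function.comp_apply, Equiv.swap_apply_of_ne_of_ne h1 h2, shiftOn,
      if_neg (disjoint_left.1 hd ha)]
  have xJ : ∀ c ∈ J, c ≠ β → x' c = x c - x β + (x α + (s + 1)) := fun c hc h2 => by
    have h1 : c ≠ α := fun e => hαJ (e ▸ hc)
    rw [hx', Function.comp_apply, Equiv.swap_apply_of_ne_of_ne h1 h2, shiftOn, if_pos hc]
    simp only [pole]
    ring
  refine ⟨fun a ha b hb hne m hm e => ?_, fun a ha b hb hne m hm e => ?_,
    fun a ha b hb m hm e => ?_⟩
  · rw [abs_le] at hm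
    by_cases h1 : a = α
    · subst h1
      rw [xα, xI b hb hne.symm] at e
      refine h.left a ha b hb hne (m - (s + 1)) (by rw [abs_le]; omega) ?_
      push_cast
      linear_combination e
    · by_cases h2 : b = α
      · subst h2
        rw [xα, xI a ha h1] at e
        refine h.left a ha b hb hne (m + (s + 1)) (by rw [abs_le]; omega) ?_
        push_cast
        linear_combination e
      · rw [xI a ha h1, xI b hb h2] at e
        exact h.left a ha b hb hne m (by rw [abs_le]; omega) e
  · rw [abs_le] at hm
    by_cases h1 : a = β
    · subst h1
      rw [xβ, xJ b hb hne.symm] at e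
      refine h.right a ha b hb hne (m + (s + 1)) (by rw [abs_le]; omega) ?_
      push_cast
      linear_combination e
    · by_cases h2 : b = β
      · subst h2
        rw [xβ, xJ a ha h1] at e
        refine h.right a ha b hb hne (m - (s + 1)) (by rw [abs_le]; omega) ?_
        push_cast
        linear_combination e
      · rw [xJ a ha h1, xJ b hb h2] at e
        refine h.right a ha b hb hne m (by rw [abs_le]; omega) ?_
        linear_combination e
  · by_cases h1 : a = β
    · by_cases h2 : b = α
      · rw [h1, h2, xα, xβ] at e
        have : ((s + 1 + m + 1 : ℕ) : K) = 0 := by push_cast; linear_combination -e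
        exact absurd this (Nat.cast_ne_zero.2 (by omega))
      · rw [h1, xβ, xI b hb h2] at e
        refine h.left α hα b hb (Ne.symm h2) (m + 1) (by rw [abs_le]; omega) ?_
        push_cast
        exact e
    · by_cases h2 : b = α
      · rw [h2, xJ a ha h1, xα] at e
        refine h.right a ha β hβ h1 (m + 1) (by rw [abs_le]; omega) ?_
        push_cast
        linear_combination e
      · rw [xJ a ha h1, xI b hb h2] at e
        refine hsep α hα β hβ b hb a ha (fun e' => h2 (Prod.mk.inj e').1.symm) (m - s)
          (by rw [abs_le]; omega) ?_
        push_cast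
        linear_combination e

omit [CharZero K] in
theorem sum_mixedResidue {I J : Finset ι} (hd : Disjoint I J) (x : ι → K) (θ : K) {N n s : ℕ}
    (hn : n ≤ N) {α β : ι} (hα : α ∈ I) (hβ : β ∈ J) :
    ∑ k ∈ I.piAntidiag n with s < k α, mixedResidue I J x θ N (α, β, s) k =
      if s < n then residueFactor (I.erase α) (J.erase β) x θ α β s *
        ∑ k ∈ I.piAntidiag (n - (s + 1)),
          sourceWeight I J (shiftOn J x (pole x (α, β, s)) ∘ Equiv.swap α β) θ k else 0 := by
  split_ifs with hs
  · obtain ⟨m, rfl⟩ : ∃ m, n = m + (s + 1) := ⟨n - (s + 1), by omega⟩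
    rw [Nat.add_sub_cancel]
    have h1 := sum_piAntidiag_add I m (s + 1) hα fun k => mixedResidue I J x θ N (α, β, s) k
    simp only [Nat.succ_le_iff] at h1
    rw [h1, mul_sum]
    refine sum_congr rfl fun k hk => ?_
    obtain ⟨A, hA, rfl⟩ : ∃ A, α ∉ A ∧ I = insert α A :=
      ⟨I.erase α, by simp, (insert_erase hα).symm⟩
    obtain ⟨B, hB, rfl⟩ : ∃ B, β ∉ B ∧ J = insert β B :=
      ⟨J.erase β, by simp, (insert_erase hβ).symm⟩
    rw [erase_insert hA, erase_insert hB]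
    refine mixedResidue_add_single hA hB hd x θ (by omega) fun a ha => ?_
    have := le_of_mem_piAntidiag hk ha
    by_cases h : a = α
    · subst h; simp; omega
    · simp [h]; omega
  · refine sum_eq_zero fun k hk => ?_
    rw [mem_filter] at hk
    have := le_of_mem_piAntidiag hk.1 hα
    omega

-- The two points differ by the constant `t`, and the weights depend only on differences.
omit [CharZero K] in
theorem sum_sourceWeight_swap_neg {I J : Finset ι} (hd : Disjoint I J) (x : ι → K) (θ t : K)
    (α β : ι) (hu : ∀ γ, γ ∈ I ∨ γ ∈ J) (n : ℕ) :
    ∑ k ∈ J.piAntidiag n, sourceWeight J I (shiftOn I (-x) t ∘ Equiv.swap β α) θ k =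
      ∑ k ∈ J.piAntidiag n, sourceWeight J I (-(shiftOn J x t ∘ Equiv.swap α β)) θ k := by
  refine sum_congr rfl fun k _ => ?_
  rw [← sourceWeight_add_const J I (-(shiftOn J x t ∘ Equiv.swap α β)) t]
  congr 1
  funext γ
  rw [Equiv.swap_comm]
  simp only [Function.comp_apply, Pi.neg_apply, shiftOn]
  rcases hu (Equiv.swap α β γ) with h | h
  · rw [if_pos h, if_neg (disjoint_left.1 hd h)]
  · rw [if_pos h, if_neg (disjoint_right.1 hd h)]; ring

/-- Partial fractions in `t` are compared term by term at `t = 0`. The induction hypothesis covers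
all non-resonant points, because exchanging coordinates need not preserve separation. -/
theorem sum_sourceWeight_of_separated {I J : Finset ι} (hd : Disjoint I J)
    (hu : ∀ γ, γ ∈ I ∨ γ ∈ J) (θ : K) {N : ℕ}
    (ih : ∀ n < N, ∀ x : ι → K, NonResonant I J x n →
      ∑ k ∈ I.piAntidiag n, sourceWeight I J x θ k =
        ∑ p ∈ antidiagonal n,
          PowerSeries.coeff p.1 (oneSubPow (((#J : K) - #I) * (θ + 1))) *
            ∑ k ∈ J.piAntidiag p.2, sourceWeight J I (-x) θ k)
    {x : ι → K} (hx : NonResonant I J x N) (hsep : Separated I J x N) :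
    ∑ k ∈ I.piAntidiag N, sourceWeight I J x θ k =
      ∑ p ∈ antidiagonal N,
        PowerSeries.coeff p.1 (oneSubPow (((#J : K) - #I) * (θ + 1))) *
          ∑ k ∈ J.piAntidiag p.2, sourceWeight J I (-x) θ k := by
  set e : ℕ → K := fun i => PowerSeries.coeff i (oneSubPow (((#J : K) - #I) * (θ + 1))) with he
  have hI := sum_sourceWeight_shiftOn hd x θ 0 le_rfl hsep.injOn_pole hx.zero_ne_pole
  have hJ : ∀ n ≤ N, _ := fun n (hn : n ≤ N) => sum_sourceWeight_shiftOn hd.symm (-x) θ 0 hn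
    hsep.neg.injOn_pole hx.neg.zero_ne_pole
  have s0 : ∀ (J : Finset ι) (x : ι → K), shiftOn J x 0 = x := fun J x => by
    funext γ; simp [shiftOn]
  simp only [s0] at hI hJ
  have hp : ∀ α β s, pole (-x) (β, α, s) = pole x (α, β, s) := fun α β s => by
    simp only [pole, Pi.neg_apply]; ring
  -- Values at infinity: the exponent `-#I (θ + 1)` is the prefactor's exponent plus `-#J (θ + 1)`.
  have hbase : ∑ k ∈ I.piAntidiag N, sourceWeight I ∅ x θ k =
      ∑ p ∈ antidiagonal N, e p.1 * ∑ k ∈ J.piAntidiag p.2, sourceWeight J ∅ (-x) θ k := by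
    rw [sum_sourceWeight_empty ⟨hx.left, by simp, by simp⟩,
      show -(#I : K) * (θ + 1) = ((#J : K) - #I) * (θ + 1) + -(#J : K) * (θ + 1) by ring,
      oneSubPow_add, PowerSeries.coeff_mul]
    refine sum_congr rfl fun p hp => ?_
    have hle : p.2 ≤ N := by
      have := HasAntidiagonal.mem_antidiagonal.1 hp
      omega
    rw [sum_sourceWeight_empty ⟨(hx.neg.mono hle).left, by simp, by simp⟩]
  -- Residues: both sides become `residueFactor` times the identity of order `N - (s + 1)` at the
  -- exchanged point.
  have hres : ∀ α ∈ I, ∀ β ∈ J, ∀ s ∈ range N,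
      ∑ k ∈ I.piAntidiag N with s < k α, mixedResidue I J x θ N (α, β, s) k =
      ∑ p ∈ antidiagonal N, e p.1 *
        ∑ k ∈ J.piAntidiag p.2 with s < k β, mixedResidue J I (-x) θ N (β, α, s) k := by
    intro α hα β hβ s hs
    have hsN := mem_range.1 hs
    have h1 : ∀ p ∈ antidiagonal N, e p.1 *
        ∑ k ∈ J.piAntidiag p.2 with s < k β, mixedResidue J I (-x) θ N (β, α, s) k =
        residueFactor (I.erase α) (J.erase β) x θ α β s *
          (e p.1 * if s < p.2 then ∑ k ∈ J.piAntidiag (p.2 - (s + 1)), sourceWeight J I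
            (-(shiftOn J x (pole x (α, β, s)) ∘ Equiv.swap α β)) θ k else 0) := by
      intro p hp'
      have hle : p.2 ≤ N := by
        have := HasAntidiagonal.mem_antidiagonal.1 hp'
        omega
      rw [sum_mixedResidue hd.symm (-x) θ hle hβ hα, residueFactor_neg, hp]
      split_ifs
      · rw [sum_sourceWeight_swap_neg hd x θ _ α β hu]; ring
      · simp
    rw [sum_congr rfl h1, ← mul_sum, sum_antidiagonal_mul_ite e (fun n => ∑ k ∈ J.piAntidiag n,
      sourceWeight J I (-(shiftOn J x (pole x (α, β, s)) ∘ Equiv.swap α β)) θ k) hsN,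
      sum_mixedResidue hd x θ le_rfl hα hβ, if_pos hsN,
      ih (N - (s + 1)) (by omega) _ (hx.swap hd hsep hsN hα hβ)]
  have hJ' : ∑ p ∈ antidiagonal N, e p.1 * ∑ k ∈ J.piAntidiag p.2, sourceWeight J I (-x) θ k =
      ∑ p ∈ antidiagonal N, e p.1 * ∑ k ∈ J.piAntidiag p.2, sourceWeight J ∅ (-x) θ k +
      ∑ α ∈ I, ∑ β ∈ J, ∑ s ∈ range N, (0 - pole x (α, β, s))⁻¹ *
        ∑ p ∈ antidiagonal N, e p.1 *
          ∑ k ∈ J.piAntidiag p.2 with s < k β, mixedResidue J I (-x) θ N (β, α, s) k := by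
    simp only [mul_sum (s := antidiagonal N)]
    simp_rw [sum_comm (s := range N) (t := antidiagonal N), sum_comm (s := J) (t := antidiagonal N),
      sum_comm (s := I) (t := antidiagonal N)]
    rw [← sum_add_distrib]
    refine sum_congr rfl fun p hp' => ?_
    have hle : p.2 ≤ N := by
      have := HasAntidiagonal.mem_antidiagonal.1 hp'
      omega
    rw [hJ p.2 hle, mul_add, mul_sum (s := J) (a := e p.1), sum_comm (s := I)]
    congr 1
    refine sum_congr rfl fun β _ => ?_
    rw [mul_sum]
    refine sum_congr rfl fun α _ => ?_
    rw [mul_sum]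
    refine sum_congr rfl fun s _ => ?_
    rw [hp]
    ring
  rw [hI, hJ', hbase]
  congr 1
  exact sum_congr rfl fun α hα => sum_congr rfl fun β hβ => sum_congr rfl fun s hs => by
    rw [hres α hα β hβ s hs]

end SourceIdentity

/-! ### Removal of genericity and the full source identity -/

section Perturbation

variable {K : Type*} [Field K] [CharZero K] {r : ℕ}

omit [CharZero K] in
theorem eventually_add_mul_ne (a : K) {c : K} (hc : c ≠ 0) (b : K) :
    ∀ᶠ t in Filter.cofinite, a + t * c ≠ b := by
  rw [Filter.eventually_cofinite]
  refine Set.Subsingleton.finite fun t ht t' ht' => ?_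
  simp only [Set.mem_ofPred_eq, not_not] at ht ht'
  apply mul_right_cancel₀ hc
  linear_combination ht - ht'

theorem two_pow_ne {α β : Fin r} (h : α ≠ β) : (2 : K) ^ (α : ℕ) - 2 ^ (β : ℕ) ≠ 0 := by
  rw [sub_ne_zero]
  intro e
  have : (2 : ℕ) ^ (α : ℕ) = 2 ^ (β : ℕ) := by exact_mod_cast e
  exact h (Fin.ext (Nat.pow_right_injective le_rfl this))

/-- Uniqueness of binary expansions. It makes the direction `2 ^ γ` separate all differences at
once, so a line in this direction is generic off finitely many points. -/
theorem two_pow_sub_ne {α β α' β' : Fin r} (h₁ : α ≠ β) (h₂ : α ≠ β') (h₃ : α' ≠ β)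
    (h : (α, β) ≠ (α', β')) :
    (2 : K) ^ (α : ℕ) - 2 ^ (β : ℕ) - (2 ^ (α' : ℕ) - 2 ^ (β' : ℕ)) ≠ 0 := by
  intro e
  have e1 : (2 : ℕ) ^ (α : ℕ) + 2 ^ (β' : ℕ) = 2 ^ (α' : ℕ) + 2 ^ (β : ℕ) := by
    have : (2 : K) ^ (α : ℕ) + 2 ^ (β' : ℕ) = 2 ^ (α' : ℕ) + 2 ^ (β : ℕ) := by
      linear_combination e
    exact_mod_cast this
  have e2 : ({(α : ℕ), (β' : ℕ)} : Finset ℕ) = {(α' : ℕ), (β : ℕ)} := by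
    apply geomSum_injective (le_refl 2)
    simp only
    rw [sum_pair (fun e => h₂ (Fin.ext e)), sum_pair (fun e => h₃ (Fin.ext e)), e1]
  have m1 : (α : ℕ) ∈ ({(α' : ℕ), (β : ℕ)} : Finset ℕ) := e2 ▸ mem_insert_self _ _
  have m2 : (β : ℕ) ∈ ({(α : ℕ), (β' : ℕ)} : Finset ℕ) := by rw [e2]; simp
  simp only [mem_insert, mem_singleton, Fin.val_inj] at m1 m2
  refine h (Prod.ext (m1.resolve_right h₁) (m2.resolve_left (Ne.symm h₁)))

theorem eventually_nonResonant_separated {I J : Finset (Fin r)} (hd : Disjoint I J)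
    (x : Fin r → K) (N : ℕ) :
    ∀ᶠ t in Filter.cofinite, NonResonant I J (fun γ => x γ + t * 2 ^ (γ : ℕ)) N ∧
      Separated I J (fun γ => x γ + t * 2 ^ (γ : ℕ)) N := by
  have hpair : ∀ α β : Fin r, α ≠ β → ∀ᶠ t in Filter.cofinite, ∀ m ∈ Icc (-N : ℤ) N,
      x α + t * 2 ^ (α : ℕ) - (x β + t * 2 ^ (β : ℕ)) ≠ m := by
    intro α β hne
    rw [Filter.eventually_all_finset]
    intro m _
    filter_upwards [eventually_add_mul_ne (x α - x β) (two_pow_ne hne) (m : K)] with t ht e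
    exact ht (by linear_combination e)
  have hpair' : ∀ᶠ t in Filter.cofinite, ∀ α β : Fin r, α ≠ β → ∀ m ∈ Icc (-N : ℤ) N,
      x α + t * 2 ^ (α : ℕ) - (x β + t * 2 ^ (β : ℕ)) ≠ m := by
    simp only [Filter.eventually_all]
    exact fun α β h => hpair α β h
  have hquad : ∀ᶠ t in Filter.cofinite, ∀ α β α' β' : Fin r, α ≠ β → α ≠ β' → α' ≠ β →
      (α, β) ≠ (α', β') → ∀ m ∈ Icc (-N : ℤ) N,
      x α + t * 2 ^ (α : ℕ) - (x β + t * 2 ^ (β : ℕ)) -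
        (x α' + t * 2 ^ (α' : ℕ) - (x β' + t * 2 ^ (β' : ℕ))) ≠ m := by
    simp only [Filter.eventually_all]
    intro α β α' β' h₁ h₂ h₃ h
    rw [Filter.eventually_all_finset]
    intro m _
    filter_upwards [eventually_add_mul_ne (x α - x β - (x α' - x β'))
      (two_pow_sub_ne h₁ h₂ h₃ h) (m : K)] with t ht e
    exact ht (by linear_combination e)
  filter_upwards [hpair', hquad] with t h1 h2
  have hIJ : ∀ α ∈ I, ∀ β ∈ J, α ≠ β := fun α hα β hβ e => disjoint_left.1 hd hα (e ▸ hβ)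
  refine ⟨⟨fun α _ β _ hne m hm => h1 α β hne m (mem_Icc.2 (abs_le.1 hm)),
    fun α _ β _ hne m hm => h1 α β hne m (mem_Icc.2 (abs_le.1 hm)),
    fun α hα β hβ m hm => ?_⟩, ?_⟩
  · have := h1 α β (hIJ β hβ α hα).symm (m + 1) (mem_Icc.2 (by omega))
    push_cast at this
    exact this
  · intro α hα β hβ α' hα' β' hβ' hne m hm
    exact h2 α β α' β' (hIJ α hα β hβ) (hIJ α hα β' hβ') (hIJ α' hα' β hβ) hne m
      (mem_Icc.2 (abs_le.1 hm))

theorem sum_sourceWeight {I J : Finset (Fin r)} (hd : Disjoint I J) (hu : ∀ γ, γ ∈ I ∨ γ ∈ J)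
    (θ : K) (N : ℕ) (x : Fin r → K) (hx : NonResonant I J x N) :
    ∑ k ∈ I.piAntidiag N, sourceWeight I J x θ k =
      ∑ p ∈ antidiagonal N,
        PowerSeries.coeff p.1 (oneSubPow (((#J : K) - #I) * (θ + 1))) *
          ∑ k ∈ J.piAntidiag p.2, sourceWeight J I (-x) θ k := by
  induction N using Nat.strong_induction_on generalizing x with
  | _ N ih =>
    have hev := eventually_nonResonant_separated hd x N
    rw [Filter.eventually_cofinite] at hev
    let y : Fin r → K → K := fun γ t => x γ + t * 2 ^ (γ : ℕ)
    have hy : ∀ γ, RegularAt 0 (y γ) := fun γ =>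
      (RegularAt.const 0 _).add ((RegularAt.id 0).mul (RegularAt.const 0 _))
    have hny : ∀ γ, RegularAt 0 fun t => -(y γ t) := fun γ => by
      simpa using (RegularAt.const 0 0).sub (hy γ)
    have y0 : (fun γ => y γ 0) = x := by funext γ; simp [y]
    have ny0 : (fun γ => -(y γ 0)) = -x := by funext γ; simp [y]
    have hL : RegularAt 0 fun t =>
        ∑ k ∈ I.piAntidiag N, sourceWeight I J (fun γ => y γ t) θ k :=
      RegularAt.sum _ fun k hk => RegularAt.sourceWeight (n := N) (by rw [y0]; exact hx)
        (fun α hα => le_of_mem_piAntidiag hk hα) hy (RegularAt.const 0 θ)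
    have hR : RegularAt 0 fun t => ∑ p ∈ antidiagonal N,
        PowerSeries.coeff p.1 (oneSubPow (((#J : K) - #I) * (θ + 1))) *
          ∑ k ∈ J.piAntidiag p.2, sourceWeight J I (fun γ => -(y γ t)) θ k := by
      refine RegularAt.sum _ fun p hp => (RegularAt.const 0 _).mul (RegularAt.sum _ fun k hk => ?_)
      refine RegularAt.sourceWeight (n := N) (x := fun γ t => -(y γ t)) (by rw [ny0]; exact hx.neg)
        (fun α hα => (le_of_mem_piAntidiag hk hα).trans ?_) hny (RegularAt.const 0 θ)
      have := HasAntidiagonal.mem_antidiagonal.1 hp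
      omega
    -- Non-resonance of `x` itself makes both sides regular at `t = 0`; the identity holds for all
    -- but finitely many `t`.
    have key := hL.eq_of_finite hR hev fun t ht => by
      simp only [Set.mem_ofPred_eq, not_not] at ht
      exact sum_sourceWeight_of_separated hd hu θ ih ht.1 ht.2
    rw [y0, ny0] at key
    exact key

theorem multiSeries_sourceWeight {I J : Finset (Fin r)} (hd : Disjoint I J) (hu : I ∪ J = univ)
    (θ : K) (x : Fin r → K)
    (hI : ∀ α ∈ I, ∀ β ∈ I, α ≠ β → ∀ n : ℤ, x α - x β ≠ n)
    (hJ : ∀ α ∈ J, ∀ β ∈ J, α ≠ β → ∀ n : ℤ, x α - x β ≠ n)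
    (hIJ : ∀ α ∈ J, ∀ β ∈ I, ∀ n : ℕ, x α - x β ≠ n + 1) :
    multiSeries I (sourceWeight I J x θ) =
      oneSubPow (((#J : K) - #I) * (θ + 1)) * multiSeries J (sourceWeight J I (-x) θ) := by
  ext n
  rw [PowerSeries.coeff_mul]
  simp only [multiSeries, PowerSeries.coeff_mk]
  refine sum_sourceWeight hd (fun γ => ?_) θ n x ⟨fun α hα β hβ h m _ => hI α hα β hβ h m,
    fun α hα β hβ h m _ => hJ α hα β hβ h m, fun α hα β hβ m _ => hIJ α hα β hβ m⟩
  rw [← mem_union, hu]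
  exact mem_univ γ

end Perturbation

end WallCrossing

theorem mainTheorem5 {K : Type*} [Field K] [CharZero K] (r : ℕ)
    (J₀ J₁ : Finset (Fin r)) (hdisj : Disjoint J₀ J₁) (hunion : J₀ ∪ J₁ = Finset.univ)
    (ε : K) (hε : ε ≠ 0) (a : Fin r → K)
    (h₀ : ∀ α ∈ J₀, ∀ β ∈ J₀, α ≠ β → ∀ n : ℤ, a α - a β ≠ n * ε)
    (h₁ : ∀ α ∈ J₁, ∀ β ∈ J₁, α ≠ β → ∀ n : ℤ, a α - a β ≠ n * ε)
    (h₀₁ : ∀ α ∈ J₀, ∀ β ∈ J₁, ∀ n : ℕ, a α - a β ≠ (n + 1) * ε) :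
    (∀ m : Fin r → K,
      WallCrossing.multiSeries J₁ (fun k =>
          WallCrossing.vandermonde J₁ (fun α => a α / ε + k α) /
            WallCrossing.vandermonde J₁ (fun α => a α / ε) *
          (∏ α ∈ J₁, ∏ β ∈ J₁,
            WallCrossing.poch (m β / ε + a α / ε) (k α) /
              WallCrossing.poch (1 + a α / ε - a β / ε) (k α)) *
          ∏ α ∈ J₁, ∏ β ∈ J₀,
            WallCrossing.poch (m β / ε + a α / ε) (k α) /
              WallCrossing.poch (1 + a α / ε - a β / ε) (k α)) =
        WallCrossing.oneSubPow (-(∑ α, (a α / ε + m α / ε)) + (J₀.card : K)) *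
        WallCrossing.multiSeries J₀ (fun k =>
          WallCrossing.vandermonde J₀ (fun α => -(a α / ε) + k α) /
            WallCrossing.vandermonde J₀ (fun α => -(a α / ε)) *
          (∏ α ∈ J₀, ∏ β ∈ J₀,
            WallCrossing.poch (-(m β / ε) + 1 - a α / ε) (k α) /
              WallCrossing.poch (1 - a α / ε + a β / ε) (k α)) *
          ∏ β ∈ J₀, ∏ α ∈ J₁,
            WallCrossing.poch (-(m α / ε) + 1 - a β / ε) (k β) /
              WallCrossing.poch (a α / ε + 1 - a β / ε) (k β))) ∧
    (∀ θ : K,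
      WallCrossing.multiSeries J₁ (fun k =>
          (∏ β ∈ J₁, ∏ α ∈ J₁,
            WallCrossing.poch (a α / ε - a β / ε - θ / ε - k β) (k α) /
              WallCrossing.poch (a α / ε - a β / ε - k β) (k α)) *
          ∏ β ∈ J₁, ∏ α ∈ J₀,
            WallCrossing.poch (a α / ε - a β / ε - θ / ε - k β) (k β) /
              WallCrossing.poch (a α / ε - a β / ε - k β) (k β)) =
        WallCrossing.oneSubPow (((J₀.card : K) - (J₁.card : K)) * (θ / ε + 1)) *
        WallCrossing.multiSeries J₀ (fun k =>
          (∏ β ∈ J₀, ∏ α ∈ J₀,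
            WallCrossing.poch (a β / ε - a α / ε - θ / ε - k β) (k α) /
              WallCrossing.poch (a β / ε - a α / ε - k β) (k α)) *
          ∏ β ∈ J₀, ∏ α ∈ J₁,
            WallCrossing.poch (a β / ε - a α / ε - θ / ε - k β) (k β) /
              WallCrossing.poch (a β / ε - a α / ε - k β) (k β))) := by
  -- Dividing by `ε` turns the exclusions of multiples of `ε` into exclusions of integers.
  have hdiv : ∀ α β, ∀ c : K, a α / ε - a β / ε = c → a α - a β = c * ε := fun α β c h => by
    rw [← h]; field_simp
  have hI : ∀ α ∈ J₁, ∀ β ∈ J₁, α ≠ β → ∀ n : ℤ, a α / ε - a β / ε ≠ n :=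
    fun α hα β hβ h n e => h₁ α hα β hβ h n (hdiv α β n e)
  have hJ : ∀ α ∈ J₀, ∀ β ∈ J₀, α ≠ β → ∀ n : ℤ, a α / ε - a β / ε ≠ n :=
    fun α hα β hβ h n e => h₀ α hα β hβ h n (hdiv α β n e)
  have hIJ : ∀ α ∈ J₀, ∀ β ∈ J₁, ∀ n : ℕ, a α / ε - a β / ε ≠ n + 1 :=
    fun α hα β hβ n e => h₀₁ α hα β hβ n (hdiv α β (n + 1) e)
  have hu : J₁ ∪ J₀ = Finset.univ := by rw [Finset.union_comm, hunion]
  refine ⟨fun m => ?_, fun θ => ?_⟩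
  · have key := WallCrossing.multiSeries_kajiharaWeight hdisj.symm hu (fun α => a α / ε)
      (fun α => m α / ε) hI hJ hIJ
    have split : ∀ (J J' : Finset (Fin r)), Disjoint J J' → J ∪ J' = Finset.univ →
        ∀ f : Fin r → Fin r → K, ∏ α ∈ J, ∏ β, f α β =
          (∏ α ∈ J, ∏ β ∈ J, f α β) * ∏ α ∈ J, ∏ β ∈ J', f α β := by
      intro J J' hd hu f
      rw [← Finset.prod_mul_distrib]
      exact Finset.prod_congr rfl fun α _ => by rw [← hu, Finset.prod_union hd]
    convert key using 1
    · refine WallCrossing.multiSeries_congr fun k => ?_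
      rw [WallCrossing.kajiharaWeight, split J₁ J₀ hdisj.symm hu, mul_assoc]
    · congr 1
      refine WallCrossing.multiSeries_congr fun k => ?_
      rw [WallCrossing.kajiharaWeight, split J₀ J₁ hdisj hunion, mul_assoc]
      congr 2
      · refine Finset.prod_congr rfl fun α _ => Finset.prod_congr rfl fun β _ => ?_
        simp only [Pi.neg_apply, Pi.sub_apply, Pi.one_apply]
        congr 2 <;> ring
      · refine Finset.prod_congr rfl fun α _ => Finset.prod_congr rfl fun β _ => ?_
        simp only [Pi.neg_apply, Pi.sub_apply, Pi.one_apply]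
        congr 2 <;> ring
  · have key := WallCrossing.multiSeries_sourceWeight hdisj.symm hu (θ / ε) (fun α => a α / ε)
      hI hJ hIJ
    refine key.trans ?_
    congr 1
    refine WallCrossing.multiSeries_congr fun k => ?_
    simp only [WallCrossing.sourceWeight, Pi.neg_apply, neg_sub_neg]
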